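/- Let $K$ be a field, $P=K[x_1,\dots,x_n]$, $\prec_m$ a degree-compatible monomial order on $P$ (smaller total degree implies smaller), and $f=(f_1,\dots,f_d)\in P^d$ with every $f_i$ homogeneous. On the module monomials $x^\alpha E_i$ of $P^d$ let $x^\alpha E_i\prec_s x^\beta E_j$ iff $i>j$, or $i=j$ and $x^\alpha\prec_m x^\beta$. **Pairs.** A pair is $p=(u,v)\in P^d\times P$ with $u\cdot f=v$; $\mathrm{lm}(p)=\mathrm{lm}(v)$, $\mathrm{lt}(p)=\mathrm{lt}(v)$, $\mathrm{sig}(p)=\mathrm{lm}(u)$ (leading monomial of $0$ is $0$); $\mathrm{index}(p)=i$ if $\mathrm{sig}(p)=x^\alpha E_i$. It is syzygy if $v=0$. Put $p_1\equiv p_2$ iff $\mathrm{sig}(p_1)=\mathrm{sig}(p_2)$ and $\mathrm{lm}(p_1)=\mathrm{lm}(p_2)$; $p_1\sim p_2$ (similar) iff $\mathrm{lm}(p_1)\mathrm{sig}(p_2)=\mathrm{lm}(p_2)\mathrm{sig}(p_1)$; $p_1\prec_p p_2$ iff $\mathrm{lm}(p_1)\mathrm{sig}(p_2)\prec_s\mathrm{lm}(p_2)\mathrm{sig}(p_1)$.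 A pair $p_1$ is top reducible by $p_2$ if both are non-syzygy, $p_1\prec_p p_2$ and $\mathrm{lm}(p_2)\mid\mathrm{lm}(p_1)$; the reduction replaces $p_1$ by $p_1-\frac{\mathrm{lt}(p_1)}{\mathrm{lt}(p_2)}p_2$. A TRP pair is a non-syzygy pair that is not top reducible by any pair; a TRB pair is a TRP pair whose signature is not properly divisible by the signature of a TRP pair similar to it. A multiplied pair $[m,p]$ consists of a monomial $m$ and a pair $p$, with value $mp$; $p_1$ is top reducible by $[m,p]$ if it is top reducible by $p$ and $\mathrm{lm}(p_1)=\mathrm{lm}(mp)$. The J-pair of two non-similar non-syzygy pairs $p_1,p_2$ is $[\mathrm{lcm}(\mathrm{lm}(p_1),\mathrm{lm}(p_2))/\mathrm{lm}(p),\,p]$, where $p$ is the $\prec_p$-smaller of the two. **Criteria.** Let $DONE$ be a set and $Rules$ a list of pairs. $[m,p]$ meets the Syzygy Criterion if some $p_1\in DONE$ has $i=\mathrm{index}(p)<\mathrm{index}(p_1)$ and $\mathrm{lm}(p_1)E_i\mid\mathrm{sig}(mp)$. It meets the Rewritten Criterion if $Rules$ has an entry whose signature divides $\mathrm{sig}(mp)$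 and the first such entry is not $p$. It passes the F5 criteria if it meets neither. A pair is F5-reducible by $DONE$ if it is top reducible by some $[m,q]$ with $q\in DONE$ that passes the F5 criteria. Put $p_1\prec_{F5}p_2$ iff $\mathrm{index}(p_1)>\mathrm{index}(p_2)$, or the indices are equal and $\deg\mathrm{lm}(p_1)<\deg\mathrm{lm}(p_2)$. **TRB-F5.** Start with $DONE=\emptyset$, $TODO=\{[1,(E_i,f_i)]: 1\le i\le d\}$ and $Rules$ empty, and repeat until $TODO=\emptyset$: (a) as long as $TODO$ contains some $[m,p]$ with $\prec_{F5}$-minimal value that passes the F5 criteria and is not yet of the form $[1,q]$ with $q$ in $Rules$, replace it by $[1,mp]$ and prepend $mp$ to $Rules$; (b) remove from $TODO$ ("select") some $[m,p]$ of smallest signature; if it does not pass the F5 criteria, discard it; (c) otherwise reduce $mp$ by successive F5 reductions by $DONE$ until the result $p'$ is not F5-reducible by $DONE$, and replace $mp$ by $p'$ in $Rules$; (d) unless $p'\equiv mp$ and $p'$ is not one of the $(E_i,f_i)$, add to $TODO$ all J-pairs of $p'$ with elements of $DONE$, and then add $p'$ to $DONE$. Choices that are left open are arbitrary. At any moment of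 a run, a signature is called considered if it is $\prec_s$ the signature of the last selected multiplied pair. **Claim.** At every moment of every run, let $p$ be a non-syzygy pair whose signature is considered. Then: 1. if $p$ is top reducible (by some pair), it is F5-reducible by $DONE$; 2. if $p$ is in $Rules$, it is in $DONE$; 3. if $p$ is TRP, there are a monomial $m_1$ and $p_1\in DONE$ such that $[m_1,p_1]$ passes the F5 criteria and $p\equiv m_1p_1$; 4. if $p$ is TRB, there is $p_1\in DONE$ with $p\equiv p_1$. Consequently TRB-F5 is a regular TRB algorithm: every output $p'$ of the reduction in (c) is not top reducible by any pair, and whenever the algorithm terminates, every TRB pair is equivalent to an element of $DONE$. -/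

import Mathlib

open MvPolynomial

noncomputable section

namespace TRBF5

/-- A homogeneous (degree-compatible) monomial order. -/
def IsHomogeneousOrder {n : ℕ} (ord : MonomialOrder (Fin n)) : Prop :=
  ∀ a b : Fin n →₀ ℕ, a.degree < b.degree → ord.toSyn a < ord.toSyn b

/-- The module monomials `x^mon · E_index` of `K[x_1, …, x_n]^d`. The parameter `ord` is only used to
put the signature order on this type. -/
@[ext]
structure Sig {n : ℕ} (ord : MonomialOrder (Fin n)) (d : ℕ) where
  index : Fin d
  mon : Fin n →₀ ℕ

namespace Sig

variable {n d : ℕ} {ord : MonomialOrder (Fin n)}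

def key (s : Sig ord d) : (Fin d)ᵒᵈ ×ₗ ord.syn :=
  toLex (OrderDual.toDual s.index, ord.toSyn s.mon)

theorem key_injective : Function.Injective (key : Sig ord d → (Fin d)ᵒᵈ ×ₗ ord.syn) := by
  intro s t h
  have h' : (OrderDual.toDual s.index, ord.toSyn s.mon) =
      (OrderDual.toDual t.index, ord.toSyn t.mon) := toLex.injective h
  rw [Prod.mk.injEq] at h'
  exact Sig.ext (OrderDual.toDual.injective h'.1) (ord.toSyn.injective h'.2)

/-- The signature order; `Sig.lt_iff` spells it out. -/
instance : LinearOrder (Sig ord d) := LinearOrder.lift' key key_injective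

theorem lt_iff (s t : Sig ord d) :
    s < t ↔ t.index < s.index ∨ (s.index = t.index ∧ ord.toSyn s.mon < ord.toSyn t.mon) := by
  change key s < key t ↔ _
  simp [key, Prod.Lex.toLex_lt_toLex]

/-- The product of the module monomial `s` by the monomial `x^a`. -/
def mul (a : Fin n →₀ ℕ) (s : Sig ord d) : Sig ord d := ⟨s.index, a + s.mon⟩

/-- Divisibility of module monomials. -/
def Divides (s t : Sig ord d) : Prop := ∃ a, t = mul a s

end Sig

/-- `PAIR`: all `(u, v)` with `u · f = v`, a submodule of `K[x]^d × K[x]`. -/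
def pairModule {K : Type*} [Field K] {n d : ℕ} (f : Fin d → MvPolynomial (Fin n) K) :
    Submodule (MvPolynomial (Fin n) K)
      ((Fin d → MvPolynomial (Fin n) K) × MvPolynomial (Fin n) K) where
  carrier := {p | ∑ i, p.1 i * f i = p.2}
  add_mem' := by
    intro p q hp hq
    simp only [Set.mem_ofPred_eq] at hp hq ⊢
    simp [add_mul, Finset.sum_add_distrib, hp, hq]
  zero_mem' := by simp
  smul_mem' := by
    intro c p hp
    simp only [Set.mem_ofPred_eq] at hp ⊢
    simp [mul_assoc, ← Finset.mul_sum, hp]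

abbrev Pair {K : Type*} [Field K] {n d : ℕ} (f : Fin d → MvPolynomial (Fin n) K) : Type _ :=
  ↥(pairModule f)

/-- Multiplied pairs `[x^a, p]`, the monomial being given by its exponent vector `a`. -/
abbrev MPair {K : Type*} [Field K] {n d : ℕ} (f : Fin d → MvPolynomial (Fin n) K) : Type _ :=
  (Fin n →₀ ℕ) × Pair f

section Pairs

variable {K : Type*} [Field K] {n d : ℕ} (ord : MonomialOrder (Fin n))
  {f : Fin d → MvPolynomial (Fin n) K}

/-- The module part `u` of a pair `(u, v)`. -/
def Pair.u (p : Pair f) : Fin d → MvPolynomial (Fin n) K := p.1.1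

/-- The polynomial part `v` of a pair `(u, v)`. -/
def Pair.v (p : Pair f) : MvPolynomial (Fin n) K := p.1.2

/-- The initial pair `(E_i, f_i)`. -/
def initialPair (f : Fin d → MvPolynomial (Fin n) K) (i : Fin d) : Pair f :=
  ⟨(Pi.single i 1, f i), by
    change ∑ j, (Pi.single i 1 : Fin d → MvPolynomial (Fin n) K) j * f j = f i
    simp [Pi.single_apply]⟩

/-- The module monomials that occur in `u`. -/
def moduleSupport (u : Fin d → MvPolynomial (Fin n) K) : Finset (Sig ord d) :=
  Finset.univ.biUnion fun i => (u i).support.image fun a => ⟨i, a⟩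

/-- `sig(p) = lm(u)`; it is `⊥` (standing for `0`) exactly if `u = 0`. -/
def sig (p : Pair f) : WithBot (Sig ord d) := (moduleSupport ord (Pair.u p)).max

open Classical in
/-- `lm(p) = lm(v)` as an exponent vector; it is `⊥` (standing for `0`) exactly if `v = 0`. -/
def lm (p : Pair f) : WithBot (Fin n →₀ ℕ) :=
  if Pair.v p = 0 then ⊥ else ((ord.degree (Pair.v p) : Fin n →₀ ℕ) : WithBot (Fin n →₀ ℕ))

/-- The leading coefficient of `v`. -/
def lc (p : Pair f) : K := ord.leadingCoeff (Pair.v p)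

/-- The product of a monomial or `0` by a module monomial or `0`. -/
def mulSig (a : WithBot (Fin n →₀ ℕ)) (s : WithBot (Sig ord d)) : WithBot (Sig ord d) :=
  WithBot.map₂ Sig.mul a s

/-- `(u₁, v₁) ≺_p (u₂, v₂)` iff `lm(v₁) lm(u₂) ≺_s lm(v₂) lm(u₁)`. -/
def PairLT (p₁ p₂ : Pair f) : Prop :=
  mulSig ord (lm ord p₁) (sig ord p₂) < mulSig ord (lm ord p₂) (sig ord p₁)

def Equivalent (p₁ p₂ : Pair f) : Prop :=
  sig ord p₁ = sig ord p₂ ∧ lm ord p₁ = lm ord p₂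

def Similar (p₁ p₂ : Pair f) : Prop :=
  mulSig ord (lm ord p₁) (sig ord p₂) = mulSig ord (lm ord p₂) (sig ord p₁)

def IsSyzygy (p : Pair f) : Prop := lm ord p = ⊥

/-- `s ∣ t` for nonzero module monomials `s = sig(p)`, `t = sig(q)`. -/
def SigDivides (s t : WithBot (Sig ord d)) : Prop :=
  ∃ s' t' : Sig ord d, s = s' ∧ t = t' ∧ s'.Divides t'

/-- `p₁` is top reducible by `p₂`. -/
def TopReducibleBy (p₁ p₂ : Pair f) : Prop :=
  ¬ IsSyzygy ord p₁ ∧ ¬ IsSyzygy ord p₂ ∧ PairLT ord p₁ p₂ ∧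
    ∃ a b : Fin n →₀ ℕ, lm ord p₁ = (a : WithBot (Fin n →₀ ℕ)) ∧
      lm ord p₂ = (b : WithBot (Fin n →₀ ℕ)) ∧ b ≤ a

/-- `p` is top reducible by some element of `PAIR`. -/
def TopReducible (p : Pair f) : Prop := ∃ q : Pair f, TopReducibleBy ord p q

/-- Top reductional prime pairs. -/
def IsTRP (p : Pair f) : Prop := ¬ IsSyzygy ord p ∧ ¬ TopReducible ord p

/-- Top reductional basis pairs: TRP pairs whose signature is not properly divisible by the
signature of a TRP pair similar to them. -/
def IsTRB (p : Pair f) : Prop :=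
  IsTRP ord p ∧ ∀ q : Pair f, IsTRP ord q → Similar ord q p →
    SigDivides ord (sig ord q) (sig ord p) → sig ord q = sig ord p

/-- The value `m p` of the multiplied pair `[m, p]`. -/
def value (x : MPair f) : Pair f := (monomial x.1 (1 : K)) • x.2

/-- `p` is top reducible by the multiplied pair `[m, q]`. -/
def TopReducibleByM (p : Pair f) (x : MPair f) : Prop :=
  TopReducibleBy ord p x.2 ∧ lm ord p = lm ord (value x)

/-- The top reduction of `p` by `[m, q]` with `lm(p) = lm(mq)`: `p - (lt(p)/lt(q)) q`. -/
def topReduct (p : Pair f) (x : MPair f) : Pair f :=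
  p - (monomial x.1 (lc ord p / lc ord x.2)) • x.2

/-- `x` is the J-pair of `p₁` and `p₂`; there is none if one of them is syzygy or if they are
similar. -/
def IsJPair (p₁ p₂ : Pair f) (x : MPair f) : Prop :=
  ¬ IsSyzygy ord p₁ ∧ ¬ IsSyzygy ord p₂ ∧ ¬ Similar ord p₁ p₂ ∧
    ((PairLT ord p₁ p₂ ∧ x.2 = p₁) ∨ (PairLT ord p₂ p₁ ∧ x.2 = p₂)) ∧
    x.1 = (ord.degree (Pair.v p₁) ⊔ ord.degree (Pair.v p₂)) - ord.degree (Pair.v x.2)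

/-- `deg(p) = |α|` for `lm(p) = x^α` (and `⊥` if `lm(p) = 0`). -/
def deg (p : Pair f) : WithBot ℕ := (lm ord p).map fun a => a.degree

/-- The order `≺_F5`. -/
def F5LT (p₁ p₂ : Pair f) : Prop :=
  ∃ s₁ s₂ : Sig ord d, sig ord p₁ = s₁ ∧ sig ord p₂ = s₂ ∧
    (s₂.index < s₁.index ∨ (s₁.index = s₂.index ∧ deg ord p₁ < deg ord p₂))

/-! The criteria -/

/-- `[m, p]` meets the Syzygy Criterion with respect to `DONE`. -/
def MeetsSyzygy (DONE : Set (Pair f)) (x : MPair f) : Prop :=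
  ∃ p₁ ∈ DONE, ∃ (s s₁ : Sig ord d) (a : Fin n →₀ ℕ),
    sig ord x.2 = s ∧ sig ord p₁ = s₁ ∧ lm ord p₁ = (a : WithBot (Fin n →₀ ℕ)) ∧
    s.index < s₁.index ∧
    SigDivides ord ((⟨s.index, a⟩ : Sig ord d) : WithBot (Sig ord d)) (sig ord (value x))

open Classical in
/-- `[m, p]` meets the Rewritten Criterion with respect to `Rules`: the first entry of `Rules` whose
signature divides `sig(mp)` exists and differs from `p`. -/
def MeetsRewritten (Rules : List (Pair f)) (x : MPair f) : Prop :=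
  ∃ q, Rules.find? (fun r => decide (SigDivides ord (sig ord r) (sig ord (value x)))) = some q ∧
    x.2 ≠ q

def PassesF5 (DONE : Set (Pair f)) (Rules : List (Pair f)) (x : MPair f) : Prop :=
  ¬ MeetsSyzygy ord DONE x ∧ ¬ MeetsRewritten ord Rules x

/-- `p` is F5 reducible by `[m, q]`. -/
def F5ReducibleBy (DONE : Set (Pair f)) (Rules : List (Pair f)) (p : Pair f) (x : MPair f) :
    Prop :=
  TopReducibleByM ord p x ∧ PassesF5 ord DONE Rules x

/-- `p` is F5 reducible by `DONE`. -/
def F5Reducible (DONE : Set (Pair f)) (Rules : List (Pair f)) (p : Pair f) : Prop :=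
  ∃ x : MPair f, x.2 ∈ DONE ∧ F5ReducibleBy ord DONE Rules p x

end Pairs

/-! The algorithm, as a nondeterministic transition system -/

/-- The point of the program that has been reached: in front of a selection; right after the
selection of a multiplied pair; inside the reduction of the value of the selected multiplied pair,
with its present intermediate result. -/
inductive Phase {K : Type*} [Field K] {n d : ℕ} (f : Fin d → MvPolynomial (Fin n) K) where
  | idle : Phase f
  | selected (x : MPair f) : Phase f
  | reducing (x : MPair f) (q : Pair f) : Phase f

structure State {K : Type*} [Field K] {n d : ℕ} (f : Fin d → MvPolynomial (Fin n) K) where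
  DONE : Set (Pair f)
  TODO : Set (MPair f)
  /-- the Rewrite Rule List, head first -/
  Rules : List (Pair f)
  /-- the last selected multiplied pair -/
  last : Option (MPair f)
  phase : Phase f

section Algorithm

variable {K : Type*} [Field K] {n d : ℕ} (ord : MonomialOrder (Fin n))
  {f : Fin d → MvPolynomial (Fin n) K}

def initialState (f : Fin d → MvPolynomial (Fin n) K) : State f where
  DONE := ∅
  TODO := Set.range fun i => ((0 : Fin n →₀ ℕ), initialPair f i)
  Rules := []
  last := none
  phase := Phase.idle

/-- `[m, p]` has to be replaced by `[1, mp]` before the next selection: it is `≺_F5`-smallest in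
`TODO`, passes the criteria and is not already of the form `[1, q]` with `q` entered in `Rules`. -/
def NeedsRule (S : State f) (x : MPair f) : Prop :=
  x ∈ S.TODO ∧ (∀ y ∈ S.TODO, ¬ F5LT ord (value y) (value x)) ∧
    PassesF5 ord S.DONE S.Rules x ∧ ¬ (x.1 = 0 ∧ x.2 ∈ S.Rules)

/-- `CheckStore` blocks the output `q` of the reduction of `p`. -/
def Blocked (p q : Pair f) : Prop :=
  (¬ ∃ i, q = initialPair f i) ∧ Equivalent ord q p

open Classical in
/-- Replacement of the entry `p` of `Rules` by `q`. -/
def replaceRule (Rules : List (Pair f)) (p q : Pair f) : List (Pair f) :=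
  Rules.map fun r => if r = p then q else r

/-- One step of TRB-F5. -/
inductive Step : State f → State f → Prop
  /-- replace `[m, p]` by `[1, mp]` in `TODO` and prepend `mp` to `Rules` -/
  | rule (S : State f) (x : MPair f) (hS : S.phase = Phase.idle) (hx : NeedsRule ord S x) :
      Step S { S with
        TODO := insert (0, value x) (S.TODO \ {x})
        Rules := value x :: S.Rules }
  /-- select a multiplied pair of smallest signature -/
  | select (S : State f) (x : MPair f) (hS : S.phase = Phase.idle)
      (hrule : ∀ y, ¬ NeedsRule ord S y) (hx : x ∈ S.TODO)
      (hmin : ∀ y ∈ S.TODO, ¬ sig ord (value y) < sig ord (value x)) :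
      Step S { S with
        TODO := S.TODO \ {x}
        last := some x
        phase := Phase.selected x }
  /-- discard a multiplied pair that meets the criteria -/
  | discard (S : State f) (x : MPair f) (hS : S.phase = Phase.selected x)
      (hx : ¬ PassesF5 ord S.DONE S.Rules x) :
      Step S { S with phase := Phase.idle }
  /-- start the reduction of a multiplied pair that passes the criteria -/
  | start (S : State f) (x : MPair f) (hS : S.phase = Phase.selected x)
      (hx : PassesF5 ord S.DONE S.Rules x) :
      Step S { S with phase := Phase.reducing x (value x) }
  /-- perform one F5 reduction by an element of `DONE` -/
  | reduce (S : State f) (x : MPair f) (q : Pair f) (y : MPair f)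
      (hS : S.phase = Phase.reducing x q) (hy : y.2 ∈ S.DONE)
      (hq : F5ReducibleBy ord S.DONE S.Rules q y) :
      Step S { S with phase := Phase.reducing x (topReduct ord q y) }
  /-- the reduction is finished and its result is stored -/
  | store (S : State f) (x : MPair f) (q : Pair f) (hS : S.phase = Phase.reducing x q)
      (hq : ¬ F5Reducible ord S.DONE S.Rules q) (hb : ¬ Blocked ord (value x) q) :
      Step S { S with
        DONE := insert q S.DONE
        TODO := S.TODO ∪ {y | ∃ p ∈ S.DONE, IsJPair ord q p y}
        Rules := replaceRule S.Rules (value x) q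
        phase := Phase.idle }
  /-- the reduction is finished and its result is blocked by `CheckStore` -/
  | block (S : State f) (x : MPair f) (q : Pair f) (hS : S.phase = Phase.reducing x q)
      (hq : ¬ F5Reducible ord S.DONE S.Rules q) (hb : Blocked ord (value x) q) :
      Step S { S with
        Rules := replaceRule S.Rules (value x) q
        phase := Phase.idle }

/-- The states that can occur in a run of TRB-F5 on the input `f`. -/
def Reachable (S : State f) : Prop := Relation.ReflTransGen (Step ord) (initialState f) S

/-- The algorithm stops and outputs `DONE`. -/
def Terminal (S : State f) : Prop := S.phase = Phase.idle ∧ S.TODO = ∅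

/-- The signature of `p` is considered. -/
def Considered (S : State f) (p : Pair f) : Prop :=
  ∃ x, S.last = some x ∧ sig ord p < sig ord (value x)

end Algorithm

/-- TRB-F5 is a regular TRB algorithm: for all homogeneous inputs, every output of its reduction
function is top irreducible by all pairs, and whenever it terminates, every TRB pair is
equivalent to an element of `DONE`. -/
def IsRegularTRB (K : Type*) [Field K] {n : ℕ} (d : ℕ) (ord : MonomialOrder (Fin n)) : Prop :=
  ∀ f : Fin d → MvPolynomial (Fin n) K, (∀ i, ∃ k, (f i).IsHomogeneous k) →
    (∀ (S : State f) (x : MPair f) (q : Pair f), Reachable ord S →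
      S.phase = Phase.reducing x q → ¬ F5Reducible ord S.DONE S.Rules q →
        ¬ TopReducible ord q) ∧
    (∀ S : State f, Reachable ord S → Terminal S →
      ∀ p : Pair f, IsTRB ord p → ∃ p₁ ∈ S.DONE, Equivalent ord p p₁)

end TRBF5

end

/-! New J-pairs have larger signature than the pair just stored, so selected signatures never
decrease. It therefore suffices to carry an invariant (`Invariant`) which says that everything below
the pending signatures has been settled, and to derive the claim from it in a single state.

The core is `Invariant.exists_of_isTRP`, an induction on the signature `s` of a TRP pair `p`. No
syzygy pair has signature `s`, since subtracting a multiple of it would leave `lm(p)` and lower the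
signature. Let `r` be the first entry of `Rules` whose signature divides `s`, say `s = m sig(r)`. It
exists, because `E_i` is the signature of an entry unless a syzygy has it. Nothing pending has
signature at most `s`, so `r` is in `DONE`. Also `[m, r]` passes the criteria: the Syzygy Criterion
would make `s` the signature of a syzygy, and the Rewritten Criterion is excluded by the choice of
`r`. If `m r` were top reducible, some TRP pair of smaller signature would have the same leading
monomial, so by induction some `q` in `DONE` would reduce `m r`. The J-pair of `r` and `q` is then
`[m', r]` with `m'` dividing `m`. It is no longer pending, so it was rejected. A syzygy cannot be
the reason, and a rewriting entry would be the first divisor of `s` too, hence `r` itself. So `m r`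
is TRP, and TRP pairs of equal signature have equal leading monomials.

A top reducible pair shares its leading monomial with a TRP pair of smaller signature, which gives
F5 reducibility, even for a pair whose signature equals that of the current one; hence reduction
outputs are irreducible.

Homogeneity and degree-compatibility maintain the invariant. The degree of a nonzero homogeneous
pair is determined by its signature, so `≺_F5` compares index and degree of signatures, apart from
zero values. Rules are thus prepended in weakly increasing index-degree order with distinct
signatures. Proper divisors have smaller degree, so no entry is rewritten by a later one. A pair of
smallest signature is `≺_F5`-minimal, so on selection it passes the criteria exactly if it is
already an entry. -/

namespace TRBF5

/-! ### Module monomials -/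

namespace Sig

variable {n d : ℕ} {ord : MonomialOrder (Fin n)}

instance : WellFoundedLT (Sig ord d) :=
  ⟨InvImage.wf (key : Sig ord d → (Fin d)ᵒᵈ ×ₗ ord.syn) wellFounded_lt⟩

@[simp] theorem mul_index (a : Fin n →₀ ℕ) (s : Sig ord d) : (mul a s).index = s.index := rfl

@[simp] theorem mul_mon (a : Fin n →₀ ℕ) (s : Sig ord d) : (mul a s).mon = a + s.mon := rfl

theorem mul_mul (a b : Fin n →₀ ℕ) (s : Sig ord d) : mul a (mul b s) = mul (a + b) s := by
  ext1 <;> simp [add_assoc]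

@[simp] theorem zero_mul (s : Sig ord d) : mul 0 s = s := by
  ext1 <;> simp

theorem mul_lt_mul_iff (a : Fin n →₀ ℕ) {s t : Sig ord d} : mul a s < mul a t ↔ s < t := by
  simp [lt_iff]

theorem le_mul (a : Fin n →₀ ℕ) (s : Sig ord d) : s ≤ mul a s := by
  rw [← not_lt, lt_iff]
  simp

theorem Divides.trans {s t r : Sig ord d} (h : s.Divides t) (h' : t.Divides r) : s.Divides r := by
  obtain ⟨a, rfl⟩ := h
  obtain ⟨b, rfl⟩ := h'
  exact ⟨b + a, mul_mul b a s⟩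

theorem Divides.le {s t : Sig ord d} (h : s.Divides t) : s ≤ t := by
  obtain ⟨a, rfl⟩ := h
  exact le_mul a s

/-- Comparison of module monomials by index and degree only. -/
def DegLE (s t : Sig ord d) : Prop :=
  t.index < s.index ∨ (s.index = t.index ∧ s.mon.degree ≤ t.mon.degree)

theorem DegLE.trans {s t r : Sig ord d} (h : DegLE s t) (h' : DegLE t r) : DegLE s r := by
  unfold DegLE at *
  grind

/-- Degree-compatibility of the order enters the proof only here. -/
theorem degLE_of_le (hord : IsHomogeneousOrder ord) {s t : Sig ord d} (h : s ≤ t) :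
    DegLE s t := by
  rw [← not_lt, lt_iff] at h
  push Not at h
  rcases h.1.lt_or_eq with h1 | h1
  · exact Or.inl h1
  · refine Or.inr ⟨h1.symm, ?_⟩
    by_contra! h2
    exact absurd (hord _ _ h2) (not_lt.2 (h.2 h1))

/-- A divisor of at least the same degree is not proper. -/
theorem Divides.eq_of_degLE {s t : Sig ord d} (h : s.Divides t) (h' : DegLE t s) : s = t := by
  obtain ⟨a, rfl⟩ := h
  rcases h' with h' | h'
  · simp at h'
  · have : a.degree = 0 := by simpa using h'.2
    rw [Finsupp.degree_eq_zero_iff] at this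
    simp [this]

end Sig

/-! ### Leading data of pairs, top reducibility, syzygies and J-pairs -/

section Algebra

variable {K : Type*} [Field K] {n d : ℕ} {ord : MonomialOrder (Fin n)}
  {f : Fin d → MvPolynomial (Fin n) K}

/-- The coefficient of the module monomial `s` in `u`. -/
def ucoeff (s : Sig ord d) (p : Pair f) : K := coeff s.mon (Pair.u p s.index)

theorem sum_u_mul (p : Pair f) : ∑ i, Pair.u p i * f i = Pair.v p := p.2

theorem u_sub (p q : Pair f) : Pair.u (p - q) = Pair.u p - Pair.u q := rfl
theorem v_sub (p q : Pair f) : Pair.v (p - q) = Pair.v p - Pair.v q := rfl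
theorem u_smul (c : MvPolynomial (Fin n) K) (p : Pair f) : Pair.u (c • p) = c • Pair.u p := rfl
theorem v_smul (c : MvPolynomial (Fin n) K) (p : Pair f) : Pair.v (c • p) = c * Pair.v p := rfl

theorem ucoeff_sub (s : Sig ord d) (p q : Pair f) : ucoeff s (p - q) = ucoeff s p - ucoeff s q := by
  simp [ucoeff, u_sub]

theorem mem_moduleSupport (p : Pair f) (s : Sig ord d) :
    s ∈ moduleSupport ord (Pair.u p) ↔ ucoeff s p ≠ 0 := by
  obtain ⟨i, a⟩ := s
  simp only [moduleSupport, Finset.mem_biUnion, Finset.mem_univ, true_and, Finset.mem_image,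
    mem_support_iff, Sig.mk.injEq, ucoeff]
  constructor
  · rintro ⟨j, b, h, rfl, rfl⟩
    exact h
  · intro h
    exact ⟨i, a, h, rfl, rfl⟩

theorem sig_eq_coe_iff (p : Pair f) (s : Sig ord d) :
    sig ord p = s ↔ ucoeff s p ≠ 0 ∧ ∀ t : Sig ord d, ucoeff t p ≠ 0 → t ≤ s := by
  constructor
  · intro h
    exact ⟨(mem_moduleSupport p s).1 (Finset.mem_of_max h), fun t ht =>
      Finset.le_max_of_eq ((mem_moduleSupport p t).2 ht) h⟩
  · rintro ⟨h1, h2⟩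
    apply le_antisymm
    · exact Finset.max_le fun t ht => WithBot.coe_le_coe.2 (h2 t ((mem_moduleSupport p t).1 ht))
    · exact Finset.le_max ((mem_moduleSupport p s).2 h1)

theorem sig_eq_bot_iff (p : Pair f) : sig ord p = ⊥ ↔ ∀ s : Sig ord d, ucoeff s p = 0 := by
  rw [sig, Finset.max_eq_bot, Finset.eq_empty_iff_forall_notMem]
  simp [mem_moduleSupport]

theorem lm_eq_coe_iff (p : Pair f) (a : Fin n →₀ ℕ) :
    lm ord p = a ↔ coeff a (Pair.v p) ≠ 0 ∧
      ∀ b, coeff b (Pair.v p) ≠ 0 → ord.toSyn b ≤ ord.toSyn a := by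
  unfold lm
  split_ifs with h
  · simp [h]
  · rw [WithBot.coe_inj]
    constructor
    · rintro rfl
      exact ⟨by simpa [MonomialOrder.leadingCoeff] using (ord.leadingCoeff_ne_zero_iff.2 h), fun b hb =>
        ord.le_degree (mem_support_iff.2 hb)⟩
    · rintro ⟨h1, h2⟩
      apply ord.toSyn.injective
      apply le_antisymm
      · exact h2 _ (by simpa [MonomialOrder.leadingCoeff] using (ord.leadingCoeff_ne_zero_iff.2 h))
      · exact ord.le_degree (mem_support_iff.2 h1)

theorem isSyzygy_iff (p : Pair f) : IsSyzygy ord p ↔ Pair.v p = 0 := by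
  unfold IsSyzygy lm
  split_ifs with h <;> simp [h]

theorem exists_lm {p : Pair f} (h : ¬ IsSyzygy ord p) :
    ∃ a : Fin n →₀ ℕ, lm ord p = (a : WithBot (Fin n →₀ ℕ)) := by
  obtain ⟨a, ha⟩ := WithBot.ne_bot_iff_exists.1 h
  exact ⟨a, ha.symm⟩

theorem not_isSyzygy_of_lm {p : Pair f} {a : Fin n →₀ ℕ}
    (h : lm ord p = (a : WithBot (Fin n →₀ ℕ))) : ¬ IsSyzygy ord p := by
  simp [IsSyzygy, h]

theorem degree_eq_of_lm {p : Pair f} {a : Fin n →₀ ℕ}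
    (h : lm ord p = (a : WithBot (Fin n →₀ ℕ))) : ord.degree (Pair.v p) = a := by
  unfold lm at h
  split_ifs at h with h1
  · simp at h
  · exact WithBot.coe_inj.1 h

theorem exists_sig {p : Pair f} (h : ¬ IsSyzygy ord p) :
    ∃ s : Sig ord d, sig ord p = (s : WithBot (Sig ord d)) := by
  by_contra! h1
  have h2 : sig ord p = ⊥ := by
    by_contra h3
    obtain ⟨s, hs⟩ := WithBot.ne_bot_iff_exists.1 h3
    exact h1 s hs.symm
  rw [sig_eq_bot_iff] at h2
  apply h
  rw [isSyzygy_iff, ← sum_u_mul]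
  apply Finset.sum_eq_zero
  intro i _
  have : Pair.u p i = 0 := by
    ext a
    exact h2 ⟨i, a⟩
  simp [this]

/-! Multiples and differences -/

theorem ucoeff_monomial_smul_mul (m : Fin n →₀ ℕ) (c : K) (p : Pair f) (s : Sig ord d) :
    ucoeff (Sig.mul m s) (monomial m c • p) = c * ucoeff s p := by
  simp [ucoeff, u_smul, coeff_monomial_mul]

theorem exists_of_ucoeff_monomial_smul_ne_zero {m : Fin n →₀ ℕ} {c : K} {p : Pair f}
    {t : Sig ord d} (h : ucoeff t (monomial m c • p) ≠ 0) :
    ∃ s, t = Sig.mul m s ∧ ucoeff s p ≠ 0 := by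
  obtain ⟨i, a⟩ := t
  simp only [ucoeff, u_smul, Pi.smul_apply, smul_eq_mul, coeff_monomial_mul', ne_eq, ite_eq_right_iff,
    not_forall] at h
  obtain ⟨h1, h2⟩ := h
  refine ⟨⟨i, a - m⟩, ?_, fun h3 => h2 (by simp only [ucoeff] at h3; simp [h3])⟩
  simp [Sig.mul, add_tsub_cancel_of_le h1]

theorem sig_monomial_smul {m : Fin n →₀ ℕ} {c : K} (hc : c ≠ 0) {p : Pair f} {s : Sig ord d}
    (h : sig ord p = s) : sig ord (monomial m c • p) = (Sig.mul m s : Sig ord d) := by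
  rw [sig_eq_coe_iff] at h ⊢
  refine ⟨by simp [ucoeff_monomial_smul_mul, hc, h.1], fun t ht => ?_⟩
  obtain ⟨r, rfl, hr⟩ := exists_of_ucoeff_monomial_smul_ne_zero ht
  rw [← not_lt, Sig.mul_lt_mul_iff, not_lt]
  exact h.2 r hr

theorem lm_monomial_smul {m : Fin n →₀ ℕ} {c : K} (hc : c ≠ 0) {p : Pair f} {a : Fin n →₀ ℕ}
    (h : lm ord p = (a : WithBot (Fin n →₀ ℕ))) :
    lm ord (monomial m c • p) = ((m + a : Fin n →₀ ℕ) : WithBot (Fin n →₀ ℕ)) := by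
  rw [lm_eq_coe_iff] at h ⊢
  rw [v_smul]
  refine ⟨by simp [coeff_monomial_mul, hc, h.1], fun b hb => ?_⟩
  simp only [coeff_monomial_mul', ne_eq, ite_eq_right_iff, not_forall] at hb
  obtain ⟨h1, h2⟩ := hb
  have := h.2 (b - m) (fun h3 => h2 (by simp [h3]))
  have h3 : b = m + (b - m) := (add_tsub_cancel_of_le h1).symm
  rw [h3]
  simpa using this

theorem sig_value {x : MPair f} {s : Sig ord d} (h : sig ord x.2 = s) :
    sig ord (value x) = (Sig.mul x.1 s : Sig ord d) := sig_monomial_smul one_ne_zero h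

theorem lm_value {x : MPair f} {a : Fin n →₀ ℕ}
    (h : lm ord x.2 = (a : WithBot (Fin n →₀ ℕ))) :
    lm ord (value x) = ((x.1 + a : Fin n →₀ ℕ) : WithBot (Fin n →₀ ℕ)) :=
  lm_monomial_smul one_ne_zero h

@[simp] theorem value_zero (p : Pair f) : value ((0 : Fin n →₀ ℕ), p) = p := by
  have : (monomial (0 : Fin n →₀ ℕ) (1 : K)) = 1 := rfl
  simp [value, this]

theorem value_isSyzygy {x : MPair f} (h : IsSyzygy ord x.2) : IsSyzygy ord (value x) := by
  rw [isSyzygy_iff] at h ⊢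
  simp [value, v_smul, h]

theorem exists_sig_of_sig_value {x : MPair f} {s : Sig ord d} (h : sig ord (value x) = s) :
    ∃ t : Sig ord d, sig ord x.2 = (t : WithBot (Sig ord d)) ∧ s = Sig.mul x.1 t := by
  rcases hx : sig ord x.2 with _ | t
  · have h1 : sig ord x.2 = ⊥ := hx
    rw [sig_eq_bot_iff] at h1
    rw [sig_eq_coe_iff] at h
    obtain ⟨r, -, hr⟩ := exists_of_ucoeff_monomial_smul_ne_zero h.1
    exact absurd (h1 r) hr
  · refine ⟨t, rfl, ?_⟩
    have := sig_value (x := x) (s := t) hx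
    rw [h] at this
    exact WithBot.coe_inj.1 this

theorem sig_sub_of_lt {p q : Pair f} {s t : Sig ord d} (hp : sig ord p = s) (hq : sig ord q = t)
    (h : t < s) : sig ord (p - q) = s := by
  rw [sig_eq_coe_iff] at hp hq ⊢
  have h0 : ∀ r, t < r → ucoeff r q = 0 := fun r hr => by
    by_contra h1
    exact absurd (hq.2 r h1) (not_le.2 hr)
  refine ⟨by rw [ucoeff_sub, h0 s h, sub_zero]; exact hp.1, fun r hr => ?_⟩
  by_contra! h1
  have h2 : ucoeff r p = 0 := by
    by_contra h2
    exact absurd (hp.2 r h2) (not_le.2 h1)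
  rw [ucoeff_sub, h2, h0 r (h.trans h1), sub_zero] at hr
  exact hr rfl

/-! Top reducibility -/

theorem topReducibleBy_iff (p q : Pair f) :
    TopReducibleBy ord p q ↔ ∃ (s t : Sig ord d) (m b : Fin n →₀ ℕ), sig ord p = s ∧
      sig ord q = t ∧ lm ord p = ((m + b : Fin n →₀ ℕ) : WithBot (Fin n →₀ ℕ)) ∧
      lm ord q = (b : WithBot (Fin n →₀ ℕ)) ∧ Sig.mul m t < s := by
  have key : ∀ (s t : Sig ord d) (m b : Fin n →₀ ℕ),
      Sig.mul (m + b) t < Sig.mul b s ↔ Sig.mul m t < s := by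
    intro s t m b
    rw [add_comm, ← Sig.mul_mul, Sig.mul_lt_mul_iff]
  constructor
  · rintro ⟨h1, h2, h3, a, b, ha, hb, hab⟩
    obtain ⟨s, hs⟩ := exists_sig h1
    obtain ⟨t, ht⟩ := exists_sig h2
    obtain ⟨m, rfl⟩ := exists_add_of_le hab
    rw [add_comm] at ha
    refine ⟨s, t, m, b, hs, ht, ha, hb, ?_⟩
    rw [PairLT, ha, hb, hs, ht] at h3
    simp only [mulSig, WithBot.map₂_coe_coe, WithBot.coe_lt_coe] at h3
    exact (key _ _ _ _).1 h3
  · rintro ⟨s, t, m, b, hs, ht, ha, hb, h⟩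
    refine ⟨not_isSyzygy_of_lm ha, not_isSyzygy_of_lm hb, ?_, _, _, ha, hb, le_add_self⟩
    rw [PairLT, ha, hb, hs, ht]
    simp only [mulSig, WithBot.map₂_coe_coe, WithBot.coe_lt_coe]
    exact (key _ _ _ _).2 h

/-- The monomial multiplier of a reducer can be absorbed into the reducer, because all pairs are
allowed. -/
theorem topReducible_iff (p : Pair f) :
    TopReducible ord p ↔ ¬ IsSyzygy ord p ∧ ∃ q : Pair f, lm ord q = lm ord p ∧
      sig ord q < sig ord p := by
  constructor
  · rintro ⟨q, hq⟩
    rw [topReducibleBy_iff] at hq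
    obtain ⟨s, t, m, b, hs, ht, ha, hb, h⟩ := hq
    refine ⟨not_isSyzygy_of_lm ha, value (m, q), ?_, ?_⟩
    · rw [ha, lm_value (x := (m, q)) hb]
    · rw [hs, sig_value (x := (m, q)) ht]
      exact WithBot.coe_lt_coe.2 h
  · rintro ⟨h1, q, h2, h3⟩
    obtain ⟨a, ha⟩ := exists_lm h1
    obtain ⟨s, hs⟩ := exists_sig h1
    rw [ha] at h2
    obtain ⟨t, ht⟩ := exists_sig (not_isSyzygy_of_lm h2)
    refine ⟨q, (topReducibleBy_iff p q).2 ⟨s, t, 0, a, hs, ht, by simpa using ha, h2, ?_⟩⟩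
    rw [hs, ht, WithBot.coe_lt_coe] at h3
    simpa using h3

theorem Equivalent.topReducible {p q : Pair f} (h : Equivalent ord p q) (hp : TopReducible ord p) :
    TopReducible ord q := by
  rw [topReducible_iff, IsSyzygy] at hp ⊢
  rwa [h.1, h.2] at hp

theorem TopReducible.value {x : MPair f} (h : TopReducible ord x.2) :
    TopReducible ord (value x) := by
  obtain ⟨q, hq⟩ := h
  rw [topReducibleBy_iff] at hq
  obtain ⟨s, t, m, b, hs, ht, ha, hb, h⟩ := hq
  refine ⟨q, (topReducibleBy_iff _ q).2 ⟨_, t, x.1 + m, b, sig_value hs, ht, ?_, hb, ?_⟩⟩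
  · rw [lm_value ha, add_assoc]
  · rwa [← Sig.mul_mul, Sig.mul_lt_mul_iff]

/-- Descent: replace a top reducible pair by one of the same leading monomial and smaller signature,
until the well-order of signatures stops the process. -/
theorem exists_isTRP_le (s : Sig ord d) : ∀ p : Pair f, ¬ IsSyzygy ord p → sig ord p = s →
    ∃ r : Pair f, IsTRP ord r ∧ lm ord r = lm ord p ∧ sig ord r ≤ sig ord p := by
  induction s using WellFoundedLT.induction with
  | ind s ih =>
    intro p hp hs
    by_cases h : TopReducible ord p
    · obtain ⟨-, q, hq, hlt⟩ := (topReducible_iff p).1 h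
      have hq' : ¬ IsSyzygy ord q := by rwa [IsSyzygy, hq]
      obtain ⟨t, ht⟩ := exists_sig hq'
      have hts : t < s := by rwa [hs, ht, WithBot.coe_lt_coe] at hlt
      obtain ⟨r, h1, h2, h3⟩ := ih t hts q hq' ht
      exact ⟨r, h1, h2.trans hq, h3.trans hlt.le⟩
    · exact ⟨p, ⟨hp, h⟩, rfl, le_rfl⟩

theorem TopReducible.exists_isTRP {p : Pair f} (h : TopReducible ord p) :
    ∃ r : Pair f, IsTRP ord r ∧ lm ord r = lm ord p ∧ sig ord r < sig ord p := by
  obtain ⟨h1, q, hq, hlt⟩ := (topReducible_iff p).1 h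
  have hq' : ¬ IsSyzygy ord q := by rwa [IsSyzygy, hq]
  obtain ⟨t, ht⟩ := exists_sig hq'
  obtain ⟨r, h2, h3, h4⟩ := exists_isTRP_le t q hq' ht
  exact ⟨r, h2, h3.trans hq, h4.trans_lt hlt⟩

/-- A pair is top reducible if its leading monomial is not the smallest one for its signature. -/
theorem topReducible_of_sig_eq {p q : Pair f} {a : Fin n →₀ ℕ}
    (ha : lm ord p = (a : WithBot (Fin n →₀ ℕ))) (h : sig ord q = sig ord p)
    (hq : ∀ b, coeff b (Pair.v q) ≠ 0 → ord.toSyn b < ord.toSyn a) : TopReducible ord p := by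
  have hp := not_isSyzygy_of_lm ha
  obtain ⟨s, hs⟩ := exists_sig hp
  rw [hs] at h
  have hs' := (sig_eq_coe_iff p s).1 hs
  have h' := (sig_eq_coe_iff q s).1 h
  -- With this `c` the signature terms cancel in `p - c q`, while `lm(p)` survives because `q` has
  -- only smaller monomials.
  set c : K := ucoeff s p / ucoeff s q with hc
  set r : Pair f := p - monomial (0 : Fin n →₀ ℕ) c • q with hr
  have hcoef : ∀ t : Sig ord d, ucoeff t r = ucoeff t p - c * ucoeff t q := by
    intro t
    rw [hr, ucoeff_sub]
    congr 1
    conv_lhs => rw [← Sig.zero_mul t]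
    rw [ucoeff_monomial_smul_mul]
  have hv : ∀ b, coeff b (Pair.v r) = coeff b (Pair.v p) - c * coeff b (Pair.v q) := by
    intro b
    rw [hr, v_sub, v_smul, coeff_sub]
    congr 1
    simp
  have ha' := (lm_eq_coe_iff p a).1 ha
  have hlm : lm ord r = (a : WithBot (Fin n →₀ ℕ)) := by
    rw [lm_eq_coe_iff]
    constructor
    · have : coeff a (Pair.v q) = 0 := by
        by_contra h0
        exact lt_irrefl _ (hq a h0)
      rw [hv, this, mul_zero, sub_zero]
      exact ha'.1
    · intro b hb
      by_cases h0 : coeff b (Pair.v q) = 0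
      · rw [hv, h0, mul_zero, sub_zero] at hb
        exact ha'.2 b hb
      · exact (hq b h0).le
  refine (topReducible_iff p).2 ⟨hp, r, hlm.trans ha.symm, ?_⟩
  obtain ⟨t, ht⟩ := exists_sig (not_isSyzygy_of_lm hlm)
  rw [ht, hs, WithBot.coe_lt_coe]
  have ht' := ((sig_eq_coe_iff r t).1 ht).1
  rw [hcoef] at ht'
  apply lt_of_le_of_ne
  · by_contra h0
    have h1 : ucoeff t p = 0 := by
      by_contra h1
      exact h0 (hs'.2 t h1)
    have h2 : ucoeff t q = 0 := by
      by_contra h1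
      exact h0 (h'.2 t h1)
    simp [h1, h2] at ht'
  · rintro rfl
    apply ht'
    rw [hc, div_mul_cancel₀ _ h'.1, sub_self]

/-- `s` is the signature of a syzygy pair. -/
def IsSyzygySig (f : Fin d → MvPolynomial (Fin n) K) (s : WithBot (Sig ord d)) : Prop :=
  ∃ z : Pair f, sig ord z = s ∧ IsSyzygy ord z

theorem IsTRP.not_isSyzygySig {p : Pair f} (h : IsTRP ord p) : ¬ IsSyzygySig f (sig ord p) := by
  rintro ⟨z, hz, hz'⟩
  obtain ⟨a, ha⟩ := exists_lm h.1
  rw [isSyzygy_iff] at hz'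
  exact h.2 (topReducible_of_sig_eq ha hz (by simp [hz']))

theorem IsSyzygySig.of_divides {s t : WithBot (Sig ord d)} (hs : IsSyzygySig f s)
    (h : SigDivides ord s t) : IsSyzygySig f t := by
  obtain ⟨s, t, rfl, rfl, a, rfl⟩ := h
  obtain ⟨z, hz, hz'⟩ := hs
  exact ⟨value (a, z), sig_value (x := (a, z)) hz, value_isSyzygy (x := (a, z)) hz'⟩

/-- Of two pairs with equal signature, the one with the larger leading monomial is top reducible. -/
theorem IsTRP.lm_eq {p q : Pair f} (hp : IsTRP ord p) (hq : IsTRP ord q)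
    (h : sig ord p = sig ord q) : lm ord p = lm ord q := by
  obtain ⟨a, ha⟩ := exists_lm hp.1
  obtain ⟨b, hb⟩ := exists_lm hq.1
  rw [ha, hb, WithBot.coe_inj]
  have ha' := (lm_eq_coe_iff p a).1 ha
  have hb' := (lm_eq_coe_iff q b).1 hb
  apply ord.toSyn.injective
  rcases lt_trichotomy (ord.toSyn a) (ord.toSyn b) with h1 | h1 | h1
  · exact absurd (topReducible_of_sig_eq hb h fun c hc => (ha'.2 c hc).trans_lt h1) hq.2
  · exact h1
  · exact absurd (topReducible_of_sig_eq ha h.symm fun c hc => (hb'.2 c hc).trans_lt h1) hp.2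

/-- The principal syzygies. -/
theorem MeetsSyzygy.isSyzygySig {D : Set (Pair f)} {x : MPair f} (h : MeetsSyzygy ord D x) :
    IsSyzygySig f (sig ord (value x)) := by
  obtain ⟨p, -, s, t, a, -, ht, ha, hst, hdiv⟩ := h
  -- The module part of `p` lives in indices beyond `s.index`, so the leading term comes from `v
  -- E_i` alone.
  refine IsSyzygySig.of_divides ⟨Pair.v p • initialPair f s.index - f s.index • p, ?_, ?_⟩ hdiv
  · have hu : ∀ j b, ucoeff (⟨j, b⟩ : Sig ord d)
        (Pair.v p • initialPair f s.index - f s.index • p) =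
        coeff b (Pair.v p * (Pi.single s.index 1 : Fin d → MvPolynomial (Fin n) K) j -
          f s.index * Pair.u p j) := fun j b => rfl
    have hz : ∀ j, j < t.index → Pair.u p j = 0 := by
      intro j hj
      ext b
      by_contra h0
      have := ((sig_eq_coe_iff p t).1 ht).2 ⟨j, b⟩ h0
      rw [← not_lt, Sig.lt_iff] at this
      exact this (Or.inl hj)
    rw [lm_eq_coe_iff] at ha
    rw [sig_eq_coe_iff]
    constructor
    · rw [hu, hz _ hst]
      simpa using ha.1
    · rintro ⟨j, b⟩ hj
      rw [hu] at hj
      rw [← not_lt, Sig.lt_iff]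
      push Not
      rcases lt_trichotomy j s.index with h1 | h1 | h1
      · rw [hz _ (h1.trans hst), Pi.single_eq_of_ne h1.ne] at hj
        simp at hj
      · subst h1
        rw [hz _ hst] at hj
        simp only [Pi.single_eq_same, mul_one, mul_zero, sub_zero] at hj
        exact ⟨le_rfl, fun _ => ha.2 b hj⟩
      · exact ⟨h1.le, fun h2 => absurd h2.symm h1.ne'⟩
  · rw [isSyzygy_iff, v_sub, v_smul, v_smul, mul_comm]
    exact sub_self _

/-! Reductions and J-pairs -/

/-- Top reduction is regular: the subtracted multiple has strictly smaller signature. -/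
theorem sig_topReduct {p : Pair f} {y : MPair f} (h : TopReducibleByM ord p y) :
    sig ord (topReduct ord p y) = sig ord p := by
  obtain ⟨h1, h2⟩ := h
  have hp := h1.1
  have hy := h1.2.1
  obtain ⟨s, t, m, b, hs, ht, ha, hb, h⟩ := (topReducibleBy_iff _ _).1 h1
  have hm : m = y.1 := by
    rw [lm_value hb, ha, WithBot.coe_inj] at h2
    exact add_right_cancel h2
  have hc : lc ord p / lc ord y.2 ≠ 0 := by
    rw [isSyzygy_iff] at hp hy
    exact div_ne_zero (ord.leadingCoeff_ne_zero_iff.2 hp) (ord.leadingCoeff_ne_zero_iff.2 hy)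
  rw [topReduct, hs]
  subst hm
  exact sig_sub_of_lt hs (sig_monomial_smul hc ht) h

/-- The leading monomial of the value is the lcm, and `≺_p` says that the other parent contributes
the smaller signature there. -/
theorem IsJPair.topReducibleBy {p₁ p₂ : Pair f} {y : MPair f} (h : IsJPair ord p₁ p₂ y) :
    ∃ q, ((y.2 = p₁ ∧ q = p₂) ∨ (y.2 = p₂ ∧ q = p₁)) ∧ TopReducibleBy ord (value y) q := by
  obtain ⟨h1, h2, -, h4, h5⟩ := h
  have key : ∀ q : Pair f, ¬ IsSyzygy ord y.2 → ¬ IsSyzygy ord q → PairLT ord y.2 q →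
      y.1 = (ord.degree (Pair.v y.2) ⊔ ord.degree (Pair.v q)) - ord.degree (Pair.v y.2) →
      TopReducibleBy ord (value y) q := by
    intro q hy hq hlt h6
    obtain ⟨a, ha⟩ := exists_lm hy
    obtain ⟨b, hb⟩ := exists_lm hq
    obtain ⟨s, hs⟩ := exists_sig hy
    obtain ⟨t, ht⟩ := exists_sig hq
    rw [degree_eq_of_lm ha, degree_eq_of_lm hb] at h6
    have h7 : y.1 + a = a ⊔ b := by rw [h6, tsub_add_cancel_of_le le_sup_left]
    obtain ⟨m, hm⟩ := exists_add_of_le (le_sup_right : b ≤ a ⊔ b)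
    rw [topReducibleBy_iff]
    refine ⟨_, t, m, b, sig_value hs, ht, ?_, hb, ?_⟩
    · rw [lm_value ha, h7, hm, add_comm]
    · rw [PairLT, ha, hb, hs, ht] at hlt
      simp only [mulSig, WithBot.map₂_coe_coe, WithBot.coe_lt_coe] at hlt
      rw [← Sig.mul_lt_mul_iff b, Sig.mul_mul, Sig.mul_mul, ← hm, ← h7, add_comm b,
        ← Sig.mul_mul, ← Sig.mul_mul, Sig.mul_lt_mul_iff]
      exact hlt
  rcases h4 with ⟨h4, h6⟩ | ⟨h4, h6⟩
  · exact ⟨p₂, Or.inl ⟨h6, rfl⟩, key p₂ (h6 ▸ h1) h2 (h6 ▸ h4) (by rw [h5, h6])⟩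
  · exact ⟨p₁, Or.inr ⟨h6, rfl⟩, key p₁ (h6 ▸ h2) h1 (h6 ▸ h4) (by rw [h5, h6, sup_comm])⟩

theorem IsJPair.symm {p₁ p₂ : Pair f} {y : MPair f} (h : IsJPair ord p₁ p₂ y) :
    IsJPair ord p₂ p₁ y := by
  obtain ⟨h1, h2, h3, h4, h5⟩ := h
  exact ⟨h2, h1, fun h => h3 h.symm, h4.symm, by rw [h5, sup_comm]⟩

/-- If a multiple `m r` is top reducible by `q`, then a divisor of `[m, r]` is the J-pair of `r`
and `q`. -/
theorem exists_isJPair {m : Fin n →₀ ℕ} {r q : Pair f}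
    (h : TopReducibleBy ord (value (m, r)) q) (hr : ¬ IsSyzygy ord r) :
    ∃ m' ≤ m, IsJPair ord r q (m', r) := by
  obtain ⟨s, t, k, b, hs, ht, ha, hb, hlt⟩ := (topReducibleBy_iff _ _).1 h
  obtain ⟨a, hra⟩ := exists_lm hr
  obtain ⟨s', hs', rfl⟩ := exists_sig_of_sig_value hs
  rw [lm_value (x := (m, r)) hra, WithBot.coe_inj] at ha
  simp only at ha hs' hlt
  have hlt' : PairLT ord r q := by
    rw [PairLT, hra, hb, hs', ht]
    simp only [mulSig, WithBot.map₂_coe_coe, WithBot.coe_lt_coe]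
    rw [← Sig.mul_lt_mul_iff m, Sig.mul_mul, Sig.mul_mul, ha, add_comm k, add_comm m,
      ← Sig.mul_mul, ← Sig.mul_mul, Sig.mul_lt_mul_iff]
    exact hlt
  refine ⟨(a ⊔ b) - a, ?_, hr, h.2.1, fun h => hlt'.ne h, Or.inl ⟨hlt', rfl⟩, ?_⟩
  -- The monomial `m + a` is a common multiple of `a` and `b`, hence a multiple of their lcm.
  · rw [tsub_le_iff_right]
    exact sup_le le_add_self (ha ▸ le_add_self)
  · simp only [degree_eq_of_lm hra, degree_eq_of_lm hb]

/-! Homogeneous pairs -/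

/-- `(u, v)` is homogeneous of degree `D` if `E_i` has degree `k i`. -/
def IsHomogeneousPair (k : Fin d → ℕ) (D : ℕ) (p : Pair f) : Prop :=
  (∀ i a, coeff a (Pair.u p i) ≠ 0 → a.degree + k i = D) ∧
    ∀ a, coeff a (Pair.v p) ≠ 0 → a.degree = D

theorem IsHomogeneousPair.monomial_smul {k : Fin d → ℕ} {D : ℕ} {p : Pair f}
    (h : IsHomogeneousPair k D p) (m : Fin n →₀ ℕ) (c : K) :
    IsHomogeneousPair k (m.degree + D) (monomial m c • p) := by
  constructor
  · intro i a ha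
    simp only [u_smul, Pi.smul_apply, smul_eq_mul, coeff_monomial_mul', ne_eq, ite_eq_right_iff,
      not_forall] at ha
    obtain ⟨h1, h2⟩ := ha
    obtain ⟨b, rfl⟩ := exists_add_of_le h1
    rw [add_tsub_cancel_left] at h2
    rw [← h.1 i b (right_ne_zero_of_mul h2), map_add, add_assoc]
  · intro a ha
    simp only [v_smul, coeff_monomial_mul', ne_eq, ite_eq_right_iff, not_forall] at ha
    obtain ⟨h1, h2⟩ := ha
    obtain ⟨b, rfl⟩ := exists_add_of_le h1
    rw [add_tsub_cancel_left] at h2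
    rw [← h.2 b (right_ne_zero_of_mul h2), map_add]

theorem IsHomogeneousPair.sub {k : Fin d → ℕ} {D : ℕ} {p q : Pair f}
    (hp : IsHomogeneousPair k D p) (hq : IsHomogeneousPair k D q) :
    IsHomogeneousPair k D (p - q) := by
  constructor
  · intro i a ha
    by_cases h : coeff a (Pair.u p i) = 0
    · refine hq.1 i a fun h' => ha ?_
      simp [u_sub, h, h']
    · exact hp.1 i a h
  · intro a ha
    by_cases h : coeff a (Pair.v p) = 0
    · refine hq.2 a fun h' => ha ?_
      simp [v_sub, h, h']
    · exact hp.2 a h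

theorem isHomogeneousPair_initialPair {k : Fin d → ℕ} (hk : ∀ i, (f i).IsHomogeneous (k i))
    (i : Fin d) : IsHomogeneousPair k (k i) (initialPair f i) := by
  constructor
  · intro j a ha
    change coeff a ((Pi.single i 1 : Fin d → MvPolynomial (Fin n) K) j) ≠ 0 at ha
    rcases eq_or_ne j i with rfl | hj
    · simp only [Pi.single_eq_same, coeff_one] at ha
      have : a = 0 := by
        by_contra h
        simp [Ne.symm h] at ha
      simp [this]
    · simp [Pi.single_eq_of_ne hj] at ha
  · intro a ha
    have := hk i ha
    rw [Finsupp.degree_eq_weight_one]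
    exact this

theorem sig_initialPair (i : Fin d) :
    sig ord (initialPair f i) = ((⟨i, 0⟩ : Sig ord d) : WithBot (Sig ord d)) := by
  have hu : ∀ j b, ucoeff (⟨j, b⟩ : Sig ord d) (initialPair f i) =
        coeff b ((Pi.single i 1 : Fin d → MvPolynomial (Fin n) K) j) := fun j b => rfl
  rw [sig_eq_coe_iff]
  constructor
  · simp [hu]
  · rintro ⟨j, b⟩ h
    rw [hu] at h
    rcases eq_or_ne j i with rfl | hj
    · simp only [Pi.single_eq_same, coeff_one] at h
      have : b = 0 := by
        by_contra h'
        simp [Ne.symm h'] at h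
      rw [this]
    · simp [Pi.single_eq_of_ne hj] at h

theorem IsHomogeneousPair.topReduct {k : Fin d → ℕ} {D D' : ℕ} {p : Pair f} {y : MPair f}
    (hp : IsHomogeneousPair k D p) (hy : IsHomogeneousPair k D' y.2)
    (h : TopReducibleByM ord p y) : IsHomogeneousPair k D (topReduct ord p y) := by
  obtain ⟨a, ha⟩ := exists_lm h.1.1
  obtain ⟨b, hb⟩ := exists_lm h.1.2.1
  have h2 := h.2
  rw [ha, lm_value hb, WithBot.coe_inj] at h2
  have h3 : y.1.degree + D' = D := by
    rw [← hp.2 a ((lm_eq_coe_iff _ _).1 ha).1, ← hy.2 b ((lm_eq_coe_iff _ _).1 hb).1, h2, map_add]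
  exact hp.sub (h3 ▸ hy.monomial_smul _ _)

/-- This translates `≺_F5` into a condition on signatures. -/
theorem IsHomogeneousPair.deg_eq {k : Fin d → ℕ} {D : ℕ} {p : Pair f}
    (hp : IsHomogeneousPair k D p) (h : ¬ IsSyzygy ord p) {s : Sig ord d} (hs : sig ord p = s) :
    deg ord p = ((s.mon.degree + k s.index : ℕ) : WithBot ℕ) := by
  obtain ⟨a, ha⟩ := exists_lm h
  rw [hp.1 _ _ ((sig_eq_coe_iff _ _).1 hs).1, ← hp.2 a ((lm_eq_coe_iff _ _).1 ha).1, deg, ha]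
  rfl

end Algebra

/-! ### The rewrite rule list -/

section Rules

variable {K : Type*} [Field K] {n d : ℕ} {ord : MonomialOrder (Fin n)}
  {f : Fin d → MvPolynomial (Fin n) K}

theorem SigDivides.trans {s t r : WithBot (Sig ord d)} (h : SigDivides ord s t)
    (h' : SigDivides ord t r) : SigDivides ord s r := by
  obtain ⟨s, t, rfl, rfl, h⟩ := h
  obtain ⟨t', r, ht, rfl, h'⟩ := h'
  obtain rfl := WithBot.coe_inj.1 ht
  exact ⟨s, r, rfl, rfl, h.trans h'⟩

theorem sigDivides_refl (s : Sig ord d) : SigDivides ord (s : WithBot (Sig ord d)) s :=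
  ⟨s, s, rfl, rfl, 0, (Sig.zero_mul s).symm⟩

/-- Comparison of nonzero module monomials by index and degree only. -/
def SigDegLE (s t : WithBot (Sig ord d)) : Prop :=
  ∃ s' t' : Sig ord d, s = s' ∧ t = t' ∧ s'.DegLE t'

theorem SigDegLE.trans {s t r : WithBot (Sig ord d)} (h : SigDegLE s t)
    (h' : SigDegLE t r) : SigDegLE s r := by
  obtain ⟨s, t, rfl, rfl, h⟩ := h
  obtain ⟨t', r, ht, rfl, h'⟩ := h'
  obtain rfl := WithBot.coe_inj.1 ht
  exact ⟨s, r, rfl, rfl, h.trans h'⟩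

theorem sigDegLE_of_le (hord : IsHomogeneousOrder ord) {s : Sig ord d} {t : WithBot (Sig ord d)}
    (h : s ≤ t) : SigDegLE (s : WithBot (Sig ord d)) t := by
  cases t with
  | bot => simp at h
  | coe t => exact ⟨s, t, rfl, rfl, Sig.degLE_of_le hord (WithBot.coe_le_coe.1 h)⟩

theorem SigDivides.eq_of_sigDegLE {s t : WithBot (Sig ord d)} (h : SigDivides ord s t)
    (h' : SigDegLE t s) : s = t := by
  obtain ⟨s, t, rfl, rfl, h⟩ := h
  obtain ⟨t', s', ht, hs, h'⟩ := h'
  obtain rfl := WithBot.coe_inj.1 ht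
  obtain rfl := WithBot.coe_inj.1 hs
  rw [h.eq_of_degLE h']

theorem meetsRewritten_iff (Rules : List (Pair f)) (x : MPair f) :
    MeetsRewritten ord Rules x ↔ ∃ q, SigDivides ord (sig ord q) (sig ord (value x)) ∧ x.2 ≠ q ∧
      ∃ as bs, Rules = as ++ q :: bs ∧
        ∀ a ∈ as, ¬ SigDivides ord (sig ord a) (sig ord (value x)) := by
  simp only [MeetsRewritten, List.find?_eq_some_iff_append, decide_eq_true_eq,
    Bool.not_eq_eq_eq_not, Bool.not_true, decide_eq_false_iff_not]
  grind

/-- Either `v` becomes the first divisor, or the first divisor does not change. -/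
theorem MeetsRewritten.cons {Rules : List (Pair f)} {x : MPair f} {v : Pair f}
    (h : MeetsRewritten ord Rules x) (hv : x.2 ≠ v) : MeetsRewritten ord (v :: Rules) x := by
  rw [meetsRewritten_iff] at h ⊢
  obtain ⟨q, hq, hne, as, bs, rfl, has⟩ := h
  by_cases hd : SigDivides ord (sig ord v) (sig ord (value x))
  · exact ⟨v, hd, hv, [], _, rfl, by simp⟩
  · exact ⟨q, hq, hne, v :: as, bs, rfl, List.forall_mem_cons.2 ⟨hd, has⟩⟩

theorem map_sig_replaceRule (Rules : List (Pair f)) {p q : Pair f} (h : sig ord q = sig ord p) :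
    (replaceRule Rules p q).map (sig ord) = Rules.map (sig ord) := by
  rw [replaceRule, List.map_map]
  apply List.map_congr_left
  intro r _
  by_cases hr : r = p <;> simp [hr, h]

theorem mem_replaceRule {Rules : List (Pair f)} {p q r : Pair f} :
    r ∈ replaceRule Rules p q ↔ (p ∈ Rules ∧ r = q) ∨ (r ∈ Rules ∧ r ≠ p) := by
  simp only [replaceRule, List.mem_map]
  constructor
  · rintro ⟨a, ha, rfl⟩
    by_cases h : a = p
    · subst h
      simp [ha]
    · simp [h, ha]
  · rintro (⟨h, rfl⟩ | ⟨h, h'⟩)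
    · exact ⟨p, h, by simp⟩
    · exact ⟨r, h, by simp [h']⟩

theorem eq_of_sig_eq {Rules : List (Pair f)} (h : (Rules.map (sig ord)).Nodup) {p q : Pair f}
    (hp : p ∈ Rules) (hq : q ∈ Rules) (hpq : sig ord p = sig ord q) : p = q :=
  List.inj_on_of_nodup_map h hp hq hpq

/-- The list of signatures is unchanged, so the first divisor keeps its position. Distinctness of
signatures prevents its new entry from being `x.2`. -/
theorem MeetsRewritten.replaceRule {Rules : List (Pair f)} {x : MPair f} {p q : Pair f}
    (h : MeetsRewritten ord Rules x) (hnd : (Rules.map (sig ord)).Nodup)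
    (hpq : sig ord q = sig ord p) (hx : x.2 ∈ Rules) :
    MeetsRewritten ord (replaceRule Rules p q) x := by
  classical
  rw [meetsRewritten_iff] at h ⊢
  obtain ⟨r, hr, hne, as, bs, rfl, has⟩ := h
  have hsig : ∀ r, sig ord (if r = p then q else r) = sig ord r := by
    intro r
    split_ifs with h
    · rw [hpq, h]
    · rfl
  refine ⟨if r = p then q else r, by rwa [hsig], ?_, as.map fun r => if r = p then q else r,
    bs.map fun r => if r = p then q else r, by simp [TRBF5.replaceRule], ?_⟩
  · intro h
    refine hne (eq_of_sig_eq hnd hx (by simp) ?_)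
    rw [h, hsig]
  · intro a ha
    obtain ⟨b, hb, rfl⟩ := List.mem_map.1 ha
    rw [hsig]
    exact has b hb

/-- The signatures of `Rules` are distinct and become larger in index and degree towards the
head. -/
structure SortedRules (ord : MonomialOrder (Fin n)) (Rules : List (Pair f)) : Prop where
  nodup : (Rules.map (sig ord)).Nodup
  sorted : (Rules.map (sig ord)).Pairwise fun s t => SigDegLE t s

theorem SortedRules.sigDegLE {as bs : List (Pair f)} {q r : Pair f}
    (h : SortedRules ord (as ++ q :: bs)) (hr : r ∈ bs) : SigDegLE (sig ord r) (sig ord q) := by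
  have := h.sorted
  rw [List.map_append, List.map_cons, List.pairwise_append] at this
  exact (List.pairwise_cons.1 this.2.1).1 _ (List.mem_map_of_mem hr)

/-- An entry of sorted rules does not meet the Rewritten Criterion. -/
theorem SortedRules.not_meetsRewritten {Rules : List (Pair f)} (h : SortedRules ord Rules)
    {r : Pair f} (hr : r ∈ Rules) {s : Sig ord d} (hs : sig ord r = s) :
    ¬ MeetsRewritten ord Rules (0, r) := by
  rw [meetsRewritten_iff]
  rintro ⟨q, hq, hne, as, bs, rfl, has⟩
  simp only [value_zero, hs] at hq has hne
  rw [List.mem_append, List.mem_cons] at hr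
  rcases hr with hr | hr | hr
  · exact has r hr (hs ▸ sigDivides_refl s)
  · exact hne hr
  · have := hq.eq_of_sigDegLE (hs ▸ h.sigDegLE hr)
    exact hne (eq_of_sig_eq h.nodup (by simp [hr]) (by simp) (hs.trans this.symm))

/-- A multiplied pair that is neither rewritten nor an entry of sorted rules has a new signature. -/
theorem SortedRules.sig_notMem {Rules : List (Pair f)} (h : SortedRules ord Rules)
    {x : MPair f} {s : Sig ord d} (hs : sig ord (value x) = s)
    (hx : ¬ MeetsRewritten ord Rules x) (hx' : ¬ (x.1 = 0 ∧ x.2 ∈ Rules)) :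
    sig ord (value x) ∉ Rules.map (sig ord) := by
  intro hmem
  obtain ⟨r, hr, hrs⟩ := List.mem_map.1 hmem
  have hdr : SigDivides ord (sig ord r) (sig ord (value x)) := by
    rw [hrs, hs]
    exact sigDivides_refl s
  obtain ⟨q, hq⟩ : ∃ q, Rules.find?
      (fun r => @decide (SigDivides ord (sig ord r) (sig ord (value x)))
        (Classical.propDecidable _)) = some q := by
    rw [← Option.isSome_iff_exists, List.find?_isSome]
    exact ⟨r, hr, by simpa using hdr⟩
  have hxq : x.2 = q := by
    by_contra hne
    exact hx ⟨q, hq, hne⟩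
  subst hxq
  simp only [List.find?_eq_some_iff_append, decide_eq_true_eq,
    Bool.not_eq_eq_eq_not, Bool.not_true, decide_eq_false_iff_not] at hq
  obtain ⟨hdq, as, bs, rfl, has⟩ := hq
  -- So `sig x.2` is a proper divisor of `sig (value x)`, of smaller degree, whereas an entry behind
  -- `x.2` has at most the index-degree of `x.2`.
  have hx1 : x.1 ≠ 0 := fun h0 => hx' ⟨h0, by simp⟩
  have hne : sig ord x.2 ≠ sig ord (value x) := by
    intro h0
    obtain ⟨t, ht, rfl⟩ := exists_sig_of_sig_value hs
    rw [hs, ht, WithBot.coe_inj] at h0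
    have := congrArg Sig.mon h0
    simp only [Sig.mul_mon, right_eq_add] at this
    exact hx1 this
  rw [List.mem_append, List.mem_cons] at hr
  rcases hr with hr | hr | hr
  · exact has r hr hdr
  · exact hne (hr ▸ hrs)
  · exact hne (hdq.eq_of_sigDegLE (hrs ▸ h.sigDegLE hr))

/-- The Syzygy Criterion depends only on the signature of the value. -/
theorem MeetsSyzygy.congr {D : Set (Pair f)} {x y : MPair f} (h : MeetsSyzygy ord D x)
    (hxy : sig ord (value x) = sig ord (value y)) : MeetsSyzygy ord D y := by
  obtain ⟨p, hp, s, t, a, hs, ht, ha, hst, hdiv⟩ := h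
  have hx := sig_value hs
  rw [hxy] at hx
  obtain ⟨s', hs', hmul⟩ := exists_sig_of_sig_value hx
  have hi : s'.index = s.index := (congrArg Sig.index hmul).symm
  exact ⟨p, hp, s', t, a, hs', ht, ha, hi ▸ hst, by rw [hi, ← hxy]; exact hdiv⟩

end Rules

/-! ### The invariant and its consequences -/

section Invariant

variable {K : Type*} [Field K] {n d : ℕ} {ord : MonomialOrder (Fin n)}
  {f : Fin d → MvPolynomial (Fin n) K}

/-- The multiplied pair that is being processed. -/
def Phase.current : Phase f → Option (MPair f)
  | Phase.idle => none
  | Phase.selected x => some x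
  | Phase.reducing x _ => some x

/-- A multiplied pair in `TODO` is initial, or its value is top reducible and its signature is not
a unit vector. -/
def IsInitialOrReducible (ord : MonomialOrder (Fin n)) (y : MPair f) : Prop :=
  (∃ i, y = (0, initialPair f i)) ∨
    (TopReducible ord (value y) ∧ ∃ s : Sig ord d, sig ord (value y) = s ∧ s.mon ≠ 0)

theorem IsInitialOrReducible.exists_sig {y : MPair f} (h : IsInitialOrReducible ord y) :
    ∃ s : Sig ord d, sig ord (value y) = s := by
  rcases h with ⟨i, rfl⟩ | ⟨-, s, hs, -⟩
  · exact ⟨_, by rw [value_zero, sig_initialPair]⟩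
  · exact ⟨s, hs⟩

theorem IsInitialOrReducible.eq_initial {y : MPair f} (h : IsInitialOrReducible ord y) {i : Fin d}
    (hi : sig ord (value y) = ((⟨i, 0⟩ : Sig ord d) : WithBot (Sig ord d))) :
    y = (0, initialPair f i) := by
  rcases h with ⟨j, rfl⟩ | ⟨-, s, hs, hs'⟩
  · rw [value_zero, sig_initialPair, WithBot.coe_inj] at hi
    obtain rfl : j = i := congrArg Sig.index hi
    rfl
  · rw [hi, WithBot.coe_inj] at hs
    exact absurd (congrArg Sig.mon hs).symm hs'

theorem IsInitialOrReducible.eq_initial_of_isSyzygy {y : MPair f}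
    (h : IsInitialOrReducible ord y) (hs : IsSyzygy ord (value y)) :
    ∃ i, y = (0, initialPair f i) := by
  rcases h with h | ⟨h, -⟩
  · exact h
  · exact absurd hs ((topReducible_iff _).1 h).1

theorem IsInitialOrReducible.normalize {x : MPair f} (h : IsInitialOrReducible ord x) :
    IsInitialOrReducible ord (0, value x) := by
  rcases h with ⟨i, rfl⟩ | h
  · exact Or.inl ⟨i, by rw [value_zero]⟩
  · refine Or.inr ?_
    rw [value_zero]
    exact h

/-- The fields that give the theorem are `todo_ge`, `done_irreducible` and the three `_processed`
ones: a rule, a unit vector or a J-pair is either still pending or accounted for. The alternatives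
for rejected pairs are chosen to be permanent: a syzygy signature does not depend on the state, and
being rewritten survives all later changes of `Rules`. The other fields maintain these. In
particular `rules_le` keeps `Rules` sorted, and `current_new` ensures that replacing a rule does not
touch an element of `DONE`. -/
structure Invariant (ord : MonomialOrder (Fin n)) (k : Fin d → ℕ) (S : State f) : Prop where
  rules : SortedRules ord S.Rules
  hom_todo : ∀ y ∈ S.TODO, ∃ D, IsHomogeneousPair k D y.2
  hom_done : ∀ p ∈ S.DONE, ∃ D, IsHomogeneousPair k D p
  todo : ∀ y ∈ S.TODO, IsInitialOrReducible ord y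
  todo_ge : ∀ z, S.last = some z → ∀ y ∈ S.TODO, sig ord (value z) ≤ sig ord (value y)
  done_irreducible : ∀ p ∈ S.DONE, ¬ TopReducible ord p
  done_le : ∀ p ∈ S.DONE, ∃ z, S.last = some z ∧ sig ord p ≤ sig ord (value z)
  done_rules : ∀ p ∈ S.DONE, p ∈ S.Rules
  rules_le : ∀ r ∈ S.Rules, ∀ y ∈ S.TODO, SigDegLE (sig ord r) (sig ord (value y))
  rules_not_meetsSyzygy : ∀ r ∈ S.Rules, ¬ MeetsSyzygy ord S.DONE (0, r)
  rules_processed : ∀ r ∈ S.Rules,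
    r ∈ S.DONE ∨ ((0 : Fin n →₀ ℕ), r) ∈ S.TODO ∨ S.phase.current = some (0, r)
  initial_processed : ∀ i, ((0 : Fin n →₀ ℕ), initialPair f i) ∈ S.TODO ∨
    IsSyzygySig f ((⟨i, 0⟩ : Sig ord d) : WithBot (Sig ord d)) ∨
    ((⟨i, 0⟩ : Sig ord d) : WithBot (Sig ord d)) ∈ S.Rules.map (sig ord)
  initial_new : ∀ i, ((0 : Fin n →₀ ℕ), initialPair f i) ∈ S.TODO →
    ∀ p ∈ S.DONE, sig ord p ≠ ((⟨i, 0⟩ : Sig ord d) : WithBot (Sig ord d))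
  jpairs_processed : ∀ r ∈ S.DONE, ∀ q ∈ S.DONE, ∀ y, IsJPair ord r q y →
    y ∈ S.TODO ∨ IsSyzygySig f (sig ord (value y)) ∨ MeetsRewritten ord S.Rules y
  current_last : ∀ x, S.phase.current = some x → S.last = some x
  current_notMem : ∀ x, S.phase.current = some x → x ∉ S.TODO
  current_hom : ∀ x, S.phase.current = some x → ∃ D, IsHomogeneousPair k D x.2
  current : ∀ x, S.phase.current = some x → IsInitialOrReducible ord x
  rules_le_current : ∀ x, S.phase.current = some x → ∀ r ∈ S.Rules,
    SigDegLE (sig ord r) (sig ord (value x))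
  current_passes : ∀ x, S.phase.current = some x →
    (PassesF5 ord S.DONE S.Rules x ↔ x.1 = 0 ∧ x.2 ∈ S.Rules)
  current_new : ∀ x, S.phase.current = some x → value x ∉ S.DONE
  reducing : ∀ x q, S.phase = Phase.reducing x q → x.1 = 0 ∧ x.2 ∈ S.Rules ∧
    sig ord q = sig ord (value x) ∧ (∃ D, IsHomogeneousPair k D q) ∧
    (q = value x ∨ TopReducible ord (value x))

namespace Invariant

variable {k : Fin d → ℕ} {S : State f}

/-- The J-pairs of elements of `DONE` are properly multiplied. -/
theorem jpair_ne_zero (hI : Invariant ord k S) {r q : Pair f} {y : MPair f} (hr : r ∈ S.DONE)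
    (hq : q ∈ S.DONE) (h : IsJPair ord r q y) : y.2 ∈ S.DONE ∧ y.1 ≠ 0 := by
  obtain ⟨q', h1, h2⟩ := h.topReducibleBy
  have hy : y.2 ∈ S.DONE := by rcases h1 with h1 | h1 <;> rw [h1.1] <;> assumption
  refine ⟨hy, fun h0 => hI.done_irreducible _ hy ⟨q', ?_⟩⟩
  have : value y = y.2 := by
    conv_lhs => rw [show y = (0, y.2) from Prod.ext h0 rfl]
    exact value_zero _
  rwa [this] at h2

/-- TRP pairs whose signatures have been processed are equivalent to admissible multiples of
elements of `DONE`. -/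
theorem exists_of_isTRP (hI : Invariant ord k S) (s : Sig ord d)
    (hTODO : ∀ y ∈ S.TODO, (s : WithBot (Sig ord d)) < sig ord (value y))
    (hcur : ∀ y, S.phase.current = some y → (s : WithBot (Sig ord d)) < sig ord (value y)) :
    ∀ p : Pair f, IsTRP ord p → sig ord p = s → ∃ x : MPair f, x.2 ∈ S.DONE ∧
      PassesF5 ord S.DONE S.Rules x ∧ Equivalent ord p (value x) := by
  induction s using WellFoundedLT.induction with
  | ind s ih =>
  intro p hp hs
  have hsyz : ∀ t, SigDivides ord t (s : WithBot (Sig ord d)) → ¬ IsSyzygySig f t :=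
    fun t ht h => hp.not_isSyzygySig (hs ▸ h.of_divides ht)
  have hEdiv : SigDivides ord ((⟨s.index, 0⟩ : Sig ord d) : WithBot (Sig ord d)) s :=
    ⟨_, s, rfl, rfl, s.mon, by ext1 <;> simp⟩
  -- The unit vector dividing `s` is neither pending nor a syzygy signature, so an entry has it as
  -- signature.
  obtain ⟨r₀, hr₀, hr₀'⟩ : ∃ r₀ ∈ S.Rules, SigDivides ord (sig ord r₀) s := by
    rcases hI.initial_processed s.index with h | h | h
    · have := hTODO _ h
      rw [value_zero, sig_initialPair, WithBot.coe_lt_coe] at this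
      obtain ⟨_, _, h1, h2, h3⟩ := hEdiv
      obtain rfl := WithBot.coe_inj.1 h1
      obtain rfl := WithBot.coe_inj.1 h2
      exact absurd this (not_lt.2 h3.le)
    · exact absurd h (hsyz _ hEdiv)
    · obtain ⟨r, hr, hr'⟩ := List.mem_map.1 h
      exact ⟨r, hr, hr' ▸ hEdiv⟩
  obtain ⟨r, hr⟩ : ∃ q, S.Rules.find?
      (fun r => @decide (SigDivides ord (sig ord r) s) (Classical.propDecidable _)) = some q := by
    rw [← Option.isSome_iff_exists, List.find?_isSome]
    exact ⟨r₀, hr₀, by simpa using hr₀'⟩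
  have hr' := hr
  simp only [List.find?_eq_some_iff_append, decide_eq_true_eq,
    Bool.not_eq_eq_eq_not, Bool.not_true, decide_eq_false_iff_not] at hr'
  obtain ⟨hdiv, as, bs, hRules, has⟩ := hr'
  obtain ⟨t, _, ht, h0, m, hm⟩ := id hdiv
  obtain rfl := WithBot.coe_inj.1 h0
  have hts : (t : WithBot (Sig ord d)) ≤ s := by
    rw [WithBot.coe_le_coe, hm]
    exact Sig.le_mul m t
  have hrD : r ∈ S.DONE := by
    rcases hI.rules_processed r (by simp [hRules]) with h | h | h
    · exact h
    · have := hTODO _ h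
      rw [value_zero, ht] at this
      exact absurd this (not_lt.2 hts)
    · have := hcur _ h
      rw [value_zero, ht] at this
      exact absurd this (not_lt.2 hts)
  have hrs : ¬ IsSyzygy ord r := fun h => hsyz _ hdiv ⟨r, rfl, h⟩
  have hval : sig ord (value (m, r)) = s := by rw [hm]; exact sig_value (x := (m, r)) ht
  have hpass : PassesF5 ord S.DONE S.Rules (m, r) := by
    constructor
    · intro h
      have := h.isSyzygySig
      rw [hval] at this
      exact hsyz _ (sigDivides_refl s) this
    · rintro ⟨q, hq, hne⟩
      rw [hval, hr] at hq
      exact hne (Option.some.inj hq)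
  refine ⟨(m, r), hrD, hpass, hs.trans hval.symm, ?_⟩
  refine hp.lm_eq ⟨?_, ?_⟩ (hs.trans hval.symm)
  · obtain ⟨a, ha⟩ := exists_lm hrs
    exact not_isSyzygy_of_lm (lm_value (x := (m, r)) ha)
  -- A reducer may be taken TRP of smaller signature, so the induction hypothesis replaces it by an
  -- element of `DONE`.
  intro htop
  obtain ⟨r', hr', hlm, hlt⟩ := htop.exists_isTRP
  obtain ⟨s', hs'⟩ := TRBF5.exists_sig hr'.1
  have hlt_sig : s' < s := by rwa [hval, hs', WithBot.coe_lt_coe] at hlt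
  have hlt_coe : (s' : WithBot (Sig ord d)) < s := WithBot.coe_lt_coe.2 hlt_sig
  obtain ⟨x, hxD, -, hxe⟩ := ih s' hlt_sig (fun y hy => hlt_coe.trans (hTODO y hy))
    (fun y hy => hlt_coe.trans (hcur y hy)) r' hr' hs'
  have hred : TopReducibleBy ord (value (m, r)) x.2 := by
    rw [topReducibleBy_iff]
    have hx : ¬ IsSyzygy ord x.2 := by
      intro h
      have := value_isSyzygy h
      rw [IsSyzygy, ← hxe.2] at this
      exact hr'.1 this
    obtain ⟨b, hb⟩ := exists_lm hx
    obtain ⟨t', ht'⟩ := TRBF5.exists_sig hx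
    refine ⟨s, t', x.1, b, hval, ht', ?_, hb, ?_⟩
    · rw [← hlm, hxe.2, lm_value hb]
    · have := hxe.1
      rw [hs', sig_value ht', WithBot.coe_inj] at this
      rwa [← this]
  obtain ⟨m', hm', hJ⟩ := exists_isJPair hred hrs
  have hval' : sig ord (value (m', r)) = (Sig.mul m' t : Sig ord d) := sig_value (x := (m', r)) ht
  have hdiv' : SigDivides ord (sig ord (value (m', r))) s := by
    rw [hval']
    refine ⟨_, s, rfl, rfl, m - m', ?_⟩
    rw [hm, Sig.mul_mul, tsub_add_cancel_of_le hm']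
  rcases hI.jpairs_processed r hrD x.2 hxD _ hJ with h | h | h
  · have := hTODO _ h
    rw [hval', WithBot.coe_lt_coe] at this
    rw [hval'] at hdiv'
    obtain ⟨_, _, h1, h2, h3⟩ := hdiv'
    obtain rfl := WithBot.coe_inj.1 h1
    obtain rfl := WithBot.coe_inj.1 h2
    exact absurd this (not_lt.2 h3.le)
  · exact hsyz _ hdiv' h
  · rw [meetsRewritten_iff] at h
    obtain ⟨q, hq, hne, as', bs', hR, has'⟩ := h
    have hrdiv : SigDivides ord (sig ord r) (sig ord (value (m', r))) := by
      rw [hval', ht]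
      exact ⟨t, _, rfl, rfl, m', rfl⟩
    -- Both `r` and `q` divide `sig(m' r)` and `s`: `r` is first for `s`, `q` is first for `sig(m'
    -- r)`, so neither precedes the other.
    have hfirst : ∀ (as as' bs bs' : List (Pair f)), as ++ r :: bs = as' ++ q :: bs' →
        (∀ a ∈ as, a ≠ q) → (∀ a ∈ as', a ≠ r) → r = q := by
      intro as as' bs bs' h h1 h2
      rcases List.append_eq_append_iff.1 h with ⟨cs, rfl, h4⟩ | ⟨cs, rfl, h4⟩
      · cases cs with
        | nil => simpa using (List.cons.inj h4).1
        | cons c cs => exact absurd (List.cons.inj h4).1.symm (h2 c (by simp))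
      · cases cs with
        | nil => simpa using (List.cons.inj h4).1.symm
        | cons c cs => exact absurd (List.cons.inj h4).1.symm (h1 c (by simp))
    refine hne (hfirst as as' bs bs' (hRules.symm.trans hR) ?_ ?_)
    · rintro a ha rfl
      exact has a ha (hq.trans hdiv')
    · rintro a ha rfl
      exact has' a ha hrdiv

/-- Up to the signatures that have been processed, top reducible pairs are F5 reducible. -/
theorem f5Reducible (hI : Invariant ord k S) {p : Pair f}
    (hTODO : ∀ y ∈ S.TODO, sig ord p ≤ sig ord (value y))
    (hcur : ∀ y, S.phase.current = some y → sig ord p ≤ sig ord (value y))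
    (hp : TopReducible ord p) : F5Reducible ord S.DONE S.Rules p := by
  obtain ⟨r, hr, hlm, hlt⟩ := hp.exists_isTRP
  obtain ⟨s, hs⟩ := TRBF5.exists_sig hr.1
  -- The TRP pair has strictly smaller signature than `p`; hence weak inequalities in the hypotheses
  -- suffice.
  obtain ⟨x, hxD, hpass, hxe⟩ := hI.exists_of_isTRP s
    (fun y hy => hs ▸ hlt.trans_le (hTODO y hy)) (fun y hy => hs ▸ hlt.trans_le (hcur y hy)) r hr hs
  refine ⟨x, hxD, ⟨?_, hlm.symm.trans hxe.2⟩, hpass⟩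
  have hx : ¬ IsSyzygy ord x.2 := by
    intro h
    have := value_isSyzygy h
    rw [IsSyzygy, ← hxe.2] at this
    exact hr.1 this
  have hpn := ((topReducible_iff p).1 hp).1
  obtain ⟨b, hb⟩ := exists_lm hx
  obtain ⟨t, ht⟩ := TRBF5.exists_sig hx
  obtain ⟨s', hs'⟩ := TRBF5.exists_sig hpn
  rw [topReducibleBy_iff]
  refine ⟨s', t, x.1, b, hs', ht, ?_, hb, ?_⟩
  · rw [← hlm, hxe.2, lm_value hb]
  · rw [hxe.1, sig_value ht, hs', WithBot.coe_lt_coe] at hlt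
    exact hlt

/-- The TRB pairs whose signatures have been processed are equivalent to elements of `DONE`. -/
theorem exists_of_isTRB (hI : Invariant ord k S) {p : Pair f}
    (hTODO : ∀ y ∈ S.TODO, sig ord p < sig ord (value y))
    (hcur : ∀ y, S.phase.current = some y → sig ord p < sig ord (value y)) (hp : IsTRB ord p) :
    ∃ q ∈ S.DONE, Equivalent ord p q := by
  obtain ⟨s, hs⟩ := TRBF5.exists_sig hp.1.1
  obtain ⟨x, hxD, -, hxe⟩ := hI.exists_of_isTRP s (fun y hy => hs ▸ hTODO y hy)
    (fun y hy => hs ▸ hcur y hy) p hp.1 hs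
  have hx : ¬ IsSyzygy ord x.2 := by
    intro h
    have := value_isSyzygy h
    rw [IsSyzygy, ← hxe.2] at this
    exact hp.1.1 this
  obtain ⟨b, hb⟩ := exists_lm hx
  obtain ⟨t, ht⟩ := TRBF5.exists_sig hx
  have h1 : sig ord p = (Sig.mul x.1 t : Sig ord d) := hxe.1.trans (sig_value ht)
  have h2 := hxe.2.trans (lm_value hb)
  have hsim : Similar ord x.2 p := by
    rw [Similar, hb, ht, h1, h2]
    simp only [mulSig, WithBot.map₂_coe_coe]
    rw [Sig.mul_mul, add_comm]
  -- The factor `x.2` is a TRP pair similar to `p` whose signature divides `sig p`, so the TRB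
  -- property forces the multiplier to be trivial.
  have heq := hp.2 x.2 ⟨hx, hI.done_irreducible _ hxD⟩ hsim
    (by rw [ht, h1]; exact ⟨t, _, rfl, rfl, x.1, rfl⟩)
  have hx0 : x.1 = 0 := by
    rw [ht, h1, WithBot.coe_inj] at heq
    have := congrArg Sig.mon heq
    simpa using this
  refine ⟨x.2, hxD, heq.symm, ?_⟩
  rw [h2, hb, hx0, zero_add]

/-- Multiplied pairs of smallest signature are `≺_F5`-minimal. -/
theorem not_f5LT (hI : Invariant ord k S) (hord : IsHomogeneousOrder ord) {x : MPair f}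
    (hx : x ∈ S.TODO) (hmin : ∀ y ∈ S.TODO, ¬ sig ord (value y) < sig ord (value x)) :
    ∀ y ∈ S.TODO, ¬ F5LT ord (value y) (value x) := by
  rintro y hy ⟨s, t, hs, ht, h⟩
  have hle : t ≤ s := by
    have := hmin y hy
    rwa [hs, ht, WithBot.coe_lt_coe, not_lt] at this
  have hdeg := Sig.degLE_of_le hord hle
  rcases h with h | ⟨h, hd⟩
  · rcases hdeg with h' | h'
    · exact absurd h h'.not_gt
    · exact h.ne h'.1
  · have hd' : t.mon.degree ≤ s.mon.degree := by
      rcases hdeg with h' | h'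
      · exact absurd h h'.ne
      · exact h'.2
    have hxs : ¬ IsSyzygy ord (value x) := by
      intro h0
      have hb : deg ord (value x) = ⊥ := by
        rw [deg, show lm ord (value x) = ⊥ from h0]
        rfl
      exact not_lt_bot (hb ▸ hd)
    obtain ⟨D, hD⟩ := hI.hom_todo x hx
    have hdx := (hD.monomial_smul x.1 1).deg_eq hxs ht
    -- A zero value has degree `⊥` and occurs only for an initial pair with `f i = 0`. Then `x` has
    -- signature `E_i` too and is the same pair.
    by_cases hys : IsSyzygy ord (value y)
    · obtain ⟨i, rfl⟩ := (hI.todo y hy).eq_initial_of_isSyzygy hys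
      rw [value_zero] at hs hys
      rw [sig_initialPair, WithBot.coe_inj] at hs
      subst hs
      have ht0 : t = ⟨i, 0⟩ := by
        ext1
        · exact h.symm
        · rw [← Finsupp.degree_eq_zero_iff]
          simpa using hd'
      have := (hI.todo x hx).eq_initial (ht0 ▸ ht)
      rw [this, value_zero] at hxs
      exact hxs hys
    · obtain ⟨D', hD'⟩ := hI.hom_todo y hy
      have hdy := (hD'.monomial_smul y.1 1).deg_eq hys hs
      change deg ord (value x) = _ at hdx
      change deg ord (value y) = _ at hdy
      rw [hdx, hdy] at hd
      have hd'' : s.mon.degree + k s.index < t.mon.degree + k t.index := WithBot.coe_lt_coe.1 hd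
      rw [h] at hd''
      omega

/-- `≺_F5`-minimal multiplied pairs have signatures of smallest index and degree. -/
theorem sigDegLE_of_not_f5LT (hI : Invariant ord k S) {x : MPair f}
    (hx : x ∈ S.TODO) (hmin : ∀ y ∈ S.TODO, ¬ F5LT ord (value y) (value x)) :
    ∀ y ∈ S.TODO, SigDegLE (sig ord (value x)) (sig ord (value y)) := by
  intro y hy
  obtain ⟨s, hs⟩ := (hI.todo x hx).exists_sig
  obtain ⟨t, ht⟩ := (hI.todo y hy).exists_sig
  refine ⟨s, t, hs, ht, ?_⟩
  have hnot : ¬ (s.index < t.index ∨ (t.index = s.index ∧ deg ord (value y) < deg ord (value x))) :=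
    fun h => hmin y hy ⟨t, s, ht, hs, h⟩
  push Not at hnot
  obtain ⟨h1, h2⟩ := hnot
  rcases h1.lt_or_eq with h1 | h1
  · exact Or.inl h1
  refine Or.inr ⟨h1.symm, ?_⟩
  have hdeg := h2 h1
  by_cases hxs : IsSyzygy ord (value x)
  · obtain ⟨i, rfl⟩ := (hI.todo x hx).eq_initial_of_isSyzygy hxs
    rw [value_zero, sig_initialPair, WithBot.coe_inj] at hs
    simp [← hs]
  · obtain ⟨D, hD⟩ := hI.hom_todo x hx
    have hdx := (hD.monomial_smul x.1 1).deg_eq hxs hs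
    change deg ord (value x) = _ at hdx
    have hys : ¬ IsSyzygy ord (value y) := by
      intro h0
      rw [hdx, deg, show lm ord (value y) = ⊥ from h0] at hdeg
      simp at hdeg
    obtain ⟨D', hD'⟩ := hI.hom_todo y hy
    have hdy := (hD'.monomial_smul y.1 1).deg_eq hys ht
    change deg ord (value y) = _ at hdy
    rw [hdx, hdy] at hdeg
    have hdeg' : s.mon.degree + k s.index ≤ t.mon.degree + k t.index :=
      WithBot.coe_le_coe.1 hdeg
    rw [h1] at hdeg'
    omega

/-- The output of the reduction is not top reducible. -/
theorem not_topReducible (hI : Invariant ord k S) {x : MPair f} {q : Pair f}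
    (hS : S.phase = Phase.reducing x q) (hq : ¬ F5Reducible ord S.DONE S.Rules q) :
    ¬ TopReducible ord q := by
  intro h
  have hc : S.phase.current = some x := by rw [hS]; rfl
  have hsig := (hI.reducing x q hS).2.2.1
  refine hq (hI.f5Reducible (fun y hy => ?_) (fun y hy => ?_) h)
  · rw [hsig]
    exact hI.todo_ge x (hI.current_last x hc) y hy
  · rw [hc] at hy
    rw [hsig, Option.some.inj hy]

/-- No output of the reduction is blocked. -/
theorem not_blocked (hI : Invariant ord k S) {x : MPair f} {q : Pair f}
    (hS : S.phase = Phase.reducing x q) (hq : ¬ F5Reducible ord S.DONE S.Rules q) :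
    ¬ Blocked ord (value x) q := by
  rintro ⟨h1, h2⟩
  have hq' := hI.not_topReducible hS hq
  have hx : ¬ TopReducible ord (value x) := fun h =>
    hq' (Equivalent.topReducible ⟨h2.1.symm, h2.2.symm⟩ h)
  have hc : S.phase.current = some x := by rw [hS]; rfl
  rcases hI.current x hc with ⟨i, rfl⟩ | h
  -- An unreduced initial pair is exempt from blocking; after at least one reduction the starting
  -- value was top reducible.
  · rcases (hI.reducing _ q hS).2.2.2.2 with h | h
    · exact h1 ⟨i, by rw [h, value_zero]⟩
    · exact hx h
  · exact hx h.1

end Invariant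

end Invariant

/-! ### Preservation of the invariant by the steps of the algorithm -/

section Steps

variable {K : Type*} [Field K] {n d : ℕ} {ord : MonomialOrder (Fin n)}
  {f : Fin d → MvPolynomial (Fin n) K} {k : Fin d → ℕ} {S : State f}

theorem invariant_initialState (hk : ∀ i, (f i).IsHomogeneous (k i)) :
    Invariant ord k (initialState f) where
  rules := ⟨List.nodup_nil, List.Pairwise.nil⟩
  hom_todo := by
    rintro _ ⟨i, rfl⟩
    exact ⟨_, isHomogeneousPair_initialPair hk i⟩
  hom_done _ h := h.elim
  todo := by
    rintro _ ⟨i, rfl⟩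
    exact Or.inl ⟨i, rfl⟩
  todo_ge _ h := by cases h
  done_irreducible _ h := h.elim
  done_le _ h := h.elim
  done_rules _ h := h.elim
  rules_le _ h := by cases h
  rules_not_meetsSyzygy _ h := by cases h
  rules_processed _ h := by cases h
  initial_processed i := Or.inl ⟨i, rfl⟩
  initial_new _ _ _ h := h.elim
  jpairs_processed _ h := h.elim
  current_last _ h := by cases h
  current_notMem _ h := by cases h
  current_hom _ h := by cases h
  current _ h := by cases h
  rules_le_current _ h := by cases h
  current_passes _ h := by cases h
  current_new _ h := by cases h
  reducing _ _ h := by cases h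

namespace Invariant

/-- The new entry has a new signature by `SortedRules.sig_notMem`, and by `≺_F5`-minimality its
index and degree do not exceed those of anything in `TODO`. -/
theorem rule (hI : Invariant ord k S) {x : MPair f} (hS : S.phase = Phase.idle)
    (hx : NeedsRule ord S x) :
    Invariant ord k { S with
        TODO := insert (0, value x) (S.TODO \ {x})
        Rules := value x :: S.Rules } := by
  obtain ⟨hxT, hmin, ⟨hsyz, hrew⟩, hnew⟩ := hx
  have hcur : S.phase.current = none := by rw [hS]; rfl
  obtain ⟨s, hs⟩ := (hI.todo x hxT).exists_sig
  have hsig := hI.rules.sig_notMem hs hrew hnew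
  have hle := hI.sigDegLE_of_not_f5LT hxT hmin
  have hfresh : ∀ r ∈ S.Rules, r ≠ value x := by
    rintro r hr rfl
    exact hsig (List.mem_map_of_mem hr)
  exact
    { rules := by
        refine ⟨?_, ?_⟩
        · rw [List.map_cons, List.nodup_cons]
          exact ⟨hsig, hI.rules.nodup⟩
        · rw [List.map_cons, List.pairwise_cons]
          refine ⟨fun t ht => ?_, hI.rules.sorted⟩
          obtain ⟨r, hr, rfl⟩ := List.mem_map.1 ht
          exact hI.rules_le r hr x hxT
      hom_todo := by
        rintro y (rfl | hy)
        · obtain ⟨D, hD⟩ := hI.hom_todo x hxT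
          exact ⟨_, hD.monomial_smul x.1 1⟩
        · exact hI.hom_todo y hy.1
      hom_done := hI.hom_done
      todo := by
        rintro y (rfl | hy)
        · exact (hI.todo x hxT).normalize
        · exact hI.todo y hy.1
      todo_ge := by
        rintro z hz y (rfl | hy)
        · rw [value_zero]
          exact hI.todo_ge z hz x hxT
        · exact hI.todo_ge z hz y hy.1
      done_irreducible := hI.done_irreducible
      done_le := hI.done_le
      done_rules := fun p hp => List.mem_cons_of_mem _ (hI.done_rules p hp)
      rules_le := by
        intro r hr y hy
        have hr' : ∀ z ∈ S.TODO, SigDegLE (sig ord r) (sig ord (value z)) := by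
          rcases List.mem_cons.1 hr with rfl | hr
          · exact hle
          · exact hI.rules_le r hr
        rcases hy with rfl | hy
        · rw [value_zero]
          exact hr' x hxT
        · exact hr' y hy.1
      rules_not_meetsSyzygy := by
        intro r hr
        rcases List.mem_cons.1 hr with rfl | hr
        · exact fun h => hsyz (h.congr (by rw [value_zero]))
        · exact hI.rules_not_meetsSyzygy r hr
      rules_processed := by
        intro r hr
        rcases List.mem_cons.1 hr with rfl | hr'
        · exact Or.inr (Or.inl (Set.mem_insert _ _))
        · rcases hI.rules_processed r hr' with h | h | h
          · exact Or.inl h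
          · refine Or.inr (Or.inl (Set.mem_insert_of_mem _ ⟨h, ?_⟩))
            rintro rfl
            exact hnew ⟨rfl, hr'⟩
          · rw [hcur] at h
            cases h
      initial_processed := by
        intro i
        rcases hI.initial_processed i with h | h | h
        · by_cases hxi : (0, initialPair f i) = x
          · refine Or.inr (Or.inr ?_)
            rw [← hxi, value_zero, List.map_cons, sig_initialPair]
            exact List.mem_cons_self
          · exact Or.inl (Set.mem_insert_of_mem _ ⟨h, hxi⟩)
        · exact Or.inr (Or.inl h)
        · exact Or.inr (Or.inr (List.mem_cons_of_mem _ h))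
      initial_new := by
        intro i hi
        refine hI.initial_new i ?_
        rcases hi with hi | hi
        · have h1 : initialPair f i = value x := congrArg Prod.snd hi
          rw [← (hI.todo x hxT).eq_initial (i := i) (by rw [← h1, sig_initialPair])]
          exact hxT
        · exact hi.1
      jpairs_processed := by
        intro r hr q hq y hy
        have hyD := hI.jpair_ne_zero hr hq hy
        have hyne : y.2 ≠ value x := hfresh _ (hI.done_rules _ hyD.1)
        rcases hI.jpairs_processed r hr q hq y hy with h | h | h
        -- If the replaced pair is the J-pair itself, the new head has its very signature and
        -- rewrites it from now on.
        · by_cases hyx : y = x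
          · subst hyx
            refine Or.inr (Or.inr ((meetsRewritten_iff _ _).2
              ⟨value y, ?_, hyne, [], S.Rules, rfl, by simp⟩))
            rw [hs]
            exact sigDivides_refl s
          · exact Or.inl (Set.mem_insert_of_mem _ ⟨h, hyx⟩)
        · exact Or.inr (Or.inl h)
        · exact Or.inr (Or.inr (h.cons hyne))
      current_last := fun y hy => by cases hcur.symm.trans hy
      current_notMem := fun y hy => by cases hcur.symm.trans hy
      current_hom := fun y hy => by cases hcur.symm.trans hy
      current := fun y hy => by cases hcur.symm.trans hy
      rules_le_current := fun y hy => by cases hcur.symm.trans hy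
      current_passes := fun y hy => by cases hcur.symm.trans hy
      current_new := fun y hy => by cases hcur.symm.trans hy
      reducing := fun y q hy => by cases hS.symm.trans hy }

/-- The selected pair is `≺_F5`-minimal; as no rule is needed, it is an entry of `Rules` or fails a
criterion. In the latter case the failure is recorded in the `_processed` fields before the pair
leaves `TODO`. -/
theorem select (hI : Invariant ord k S) (hord : IsHomogeneousOrder ord) {x : MPair f}
    (hS : S.phase = Phase.idle) (hrule : ∀ y, ¬ NeedsRule ord S y) (hx : x ∈ S.TODO)
    (hmin : ∀ y ∈ S.TODO, ¬ sig ord (value y) < sig ord (value x)) :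
    Invariant ord k { S with
        TODO := S.TODO \ {x}
        last := some x
        phase := Phase.selected x } := by
  have hcur : S.phase.current = none := by rw [hS]; rfl
  obtain ⟨s, hs⟩ := (hI.todo x hx).exists_sig
  have hpass : PassesF5 ord S.DONE S.Rules x ↔ x.1 = 0 ∧ x.2 ∈ S.Rules := by
    constructor
    · intro h
      by_contra h'
      exact hrule x ⟨hx, hI.not_f5LT hord hx hmin, h, h'⟩
    · rintro ⟨h1, h2⟩
      have hx0 : x = (0, x.2) := Prod.ext h1 rfl
      rw [hx0, value_zero] at hs
      rw [hx0]
      exact ⟨hI.rules_not_meetsSyzygy _ h2, hI.rules.not_meetsRewritten h2 hs⟩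
  have hnot : ¬ (x.1 = 0 ∧ x.2 ∈ S.Rules) →
      IsSyzygySig f (sig ord (value x)) ∨ MeetsRewritten ord S.Rules x := by
    intro h
    rw [← hpass, PassesF5, not_and_or, not_not, not_not] at h
    exact h.imp (fun h => h.isSyzygySig) id
  exact
    { rules := hI.rules
      hom_todo := fun y hy => hI.hom_todo y hy.1
      hom_done := hI.hom_done
      todo := fun y hy => hI.todo y hy.1
      todo_ge := by
        intro z hz y hy
        obtain rfl := Option.some.inj hz
        exact not_lt.1 (hmin y hy.1)
      done_irreducible := hI.done_irreducible
      done_le := by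
        intro p hp
        obtain ⟨z, hz, hpz⟩ := hI.done_le p hp
        exact ⟨x, rfl, hpz.trans (hI.todo_ge z hz x hx)⟩
      done_rules := hI.done_rules
      rules_le := fun r hr y hy => hI.rules_le r hr y hy.1
      rules_not_meetsSyzygy := hI.rules_not_meetsSyzygy
      rules_processed := by
        intro r hr
        rcases hI.rules_processed r hr with h | h | h
        · exact Or.inl h
        · by_cases hrx : (0, r) = x
          · exact Or.inr (Or.inr (congrArg some hrx.symm))
          · exact Or.inr (Or.inl ⟨h, hrx⟩)
        · rw [hcur] at h
          cases h
      initial_processed := by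
        intro i
        rcases hI.initial_processed i with h | h | h
        · by_cases hxi : (0, initialPair f i) = x
          · refine Or.inr ?_
            have hsx : sig ord (value x) = ((⟨i, 0⟩ : Sig ord d) : WithBot (Sig ord d)) := by
              rw [← hxi, value_zero, sig_initialPair]
            by_cases hxR : x.1 = 0 ∧ x.2 ∈ S.Rules
            · refine Or.inr (List.mem_map.2 ⟨x.2, hxR.2, ?_⟩)
              rw [← hxi, sig_initialPair]
            · rw [← hsx]
              refine (hnot hxR).imp id fun hrew => ?_
              obtain ⟨q, hq, -, as, bs, hR, -⟩ := (meetsRewritten_iff _ _).1 hrew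
              -- A signature dividing a unit vector equals it.
              refine List.mem_map.2 ⟨q, by simp [hR], hq.eq_of_sigDegLE ?_⟩
              obtain ⟨s', t', hs', ht', a, ha⟩ := hq
              rw [hsx, WithBot.coe_inj] at ht'
              rw [hsx, hs']
              refine ⟨_, _, rfl, rfl, Or.inr ⟨?_, by simp⟩⟩
              rw [ht', ha]
              rfl
          · exact Or.inl ⟨h, hxi⟩
        · exact Or.inr (Or.inl h)
        · exact Or.inr (Or.inr h)
      initial_new := fun i hi => hI.initial_new i hi.1
      jpairs_processed := by
        intro r hr q hq y hy
        have hyD := hI.jpair_ne_zero hr hq hy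
        rcases hI.jpairs_processed r hr q hq y hy with h | h | h
        · by_cases hyx : y = x
          · subst hyx
            exact Or.inr (hnot fun h => hyD.2 h.1)
          · exact Or.inl ⟨h, hyx⟩
        · exact Or.inr (Or.inl h)
        · exact Or.inr (Or.inr h)
      current_last := fun y hy => hy
      current_notMem := by
        intro y hy hyT
        exact hyT.2 (Option.some.inj hy).symm
      current_hom := by
        intro y hy
        obtain rfl := Option.some.inj hy
        exact hI.hom_todo x hx
      current := by
        intro y hy
        obtain rfl := Option.some.inj hy
        exact hI.todo x hx
      rules_le_current := by
        intro y hy r hr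
        obtain rfl := Option.some.inj hy
        exact hI.rules_le r hr x hx
      current_passes := by
        intro y hy
        obtain rfl := Option.some.inj hy
        exact hpass
      current_new := by
        intro y hy hyD
        obtain rfl := Option.some.inj hy
        rcases hI.todo x hx with ⟨i, rfl⟩ | h
        · exact hI.initial_new i hx _ hyD (by rw [value_zero, sig_initialPair])
        · exact hI.done_irreducible _ hyD h.1
      reducing := fun y q hy => by cases hy }

theorem discard (hI : Invariant ord k S) {x : MPair f} (hS : S.phase = Phase.selected x)
    (hx : ¬ PassesF5 ord S.DONE S.Rules x) : Invariant ord k { S with phase := Phase.idle } := by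
  have hcur : S.phase.current = some x := by rw [hS]; rfl
  exact
    { hI with
      rules_processed := by
        intro r hr
        rcases hI.rules_processed r hr with h | h | h
        · exact Or.inl h
        · exact Or.inr (Or.inl h)
        · rw [hcur] at h
          obtain rfl := Option.some.inj h
          exact absurd ((hI.current_passes _ hcur).2 ⟨rfl, hr⟩) hx
      current_last := fun y hy => by cases hy
      current_notMem := fun y hy => by cases hy
      current_hom := fun y hy => by cases hy
      current := fun y hy => by cases hy
      rules_le_current := fun y hy => by cases hy
      current_passes := fun y hy => by cases hy
      current_new := fun y hy => by cases hy
      reducing := fun y q hy => by cases hy }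

/-- A change of the phase that keeps the current multiplied pair. -/
theorem reducing_of_current (hI : Invariant ord k S) {x : MPair f} {q : Pair f}
    (hcur : S.phase.current = some x) (hq : x.1 = 0 ∧ x.2 ∈ S.Rules ∧
      sig ord q = sig ord (value x) ∧ (∃ D, IsHomogeneousPair k D q) ∧
      (q = value x ∨ TopReducible ord (value x))) :
    Invariant ord k { S with phase := Phase.reducing x q } := by
  have hc : (Phase.reducing x q).current = S.phase.current := hcur.symm
  exact
    { hI with
      rules_processed := by simpa only [hc] using hI.rules_processed
      current_last := by simpa only [hc] using hI.current_last
      current_notMem := by simpa only [hc] using hI.current_notMem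
      current_hom := by simpa only [hc] using hI.current_hom
      current := by simpa only [hc] using hI.current
      rules_le_current := by simpa only [hc] using hI.rules_le_current
      current_passes := by simpa only [hc] using hI.current_passes
      current_new := by simpa only [hc] using hI.current_new
      reducing := by
        intro y q' hy
        obtain ⟨rfl, rfl⟩ := Phase.reducing.inj hy
        exact hq }

theorem start (hI : Invariant ord k S) {x : MPair f} (hS : S.phase = Phase.selected x)
    (hx : PassesF5 ord S.DONE S.Rules x) :
    Invariant ord k { S with phase := Phase.reducing x (value x) } := by
  have hcur : S.phase.current = some x := by rw [hS]; rfl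
  obtain ⟨h1, h2⟩ := (hI.current_passes x hcur).1 hx
  obtain ⟨D, hD⟩ := hI.current_hom x hcur
  exact hI.reducing_of_current hcur ⟨h1, h2, rfl, ⟨_, hD.monomial_smul x.1 1⟩, Or.inl rfl⟩

theorem reduce (hI : Invariant ord k S) {x : MPair f} {q : Pair f} {y : MPair f}
    (hS : S.phase = Phase.reducing x q) (hy : y.2 ∈ S.DONE)
    (hq : F5ReducibleBy ord S.DONE S.Rules q y) :
    Invariant ord k { S with phase := Phase.reducing x (topReduct ord q y) } := by
  have hcur : S.phase.current = some x := by rw [hS]; rfl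
  obtain ⟨h1, h2, h3, ⟨D, hD⟩, h5⟩ := hI.reducing x q hS
  obtain ⟨D', hD'⟩ := hI.hom_done _ hy
  refine hI.reducing_of_current hcur ⟨h1, h2, (sig_topReduct hq.1).trans h3,
    ⟨D, hD.topReduct hD' hq.1⟩, Or.inr ?_⟩
  rcases h5 with rfl | h5
  · exact ⟨y.2, hq.1.1⟩
  · exact h5

/-- The J-pairs of the output of the reduction with elements of `DONE` have larger signatures than
it. -/
theorem jpair_store (hI : Invariant ord k S) {x : MPair f} {q : Pair f}
    (hS : S.phase = Phase.reducing x q) (hq : ¬ TopReducible ord q)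
    {p : Pair f} (hp : p ∈ S.DONE) {y : MPair f} (hy : IsJPair ord q p y) :
    sig ord (value x) < sig ord (value y) ∧ (∃ D, IsHomogeneousPair k D y.2) ∧
      TopReducible ord (value y) ∧ ∃ s : Sig ord d, sig ord (value y) = s ∧ s.mon ≠ 0 := by
  have hcur : S.phase.current = some x := by rw [hS]; rfl
  obtain ⟨-, -, hsig, hhom, -⟩ := hI.reducing x q hS
  obtain ⟨q', h1, h2⟩ := hy.topReducibleBy
  obtain ⟨s, t, m, b, hs, ht, -, -, hlt⟩ := (topReducibleBy_iff _ _).1 h2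
  obtain ⟨s', hs', rfl⟩ := exists_sig_of_sig_value hs
  have hle : sig ord y.2 ≤ sig ord (value x) := by
    rcases h1 with ⟨h1, -⟩ | ⟨h1, -⟩
    · rw [h1, hsig]
    · rw [h1]
      obtain ⟨z, hz, hpz⟩ := hI.done_le p hp
      rw [hI.current_last x hcur] at hz
      obtain rfl := Option.some.inj hz
      exact hpz
  have hlt : sig ord (value x) < sig ord (value y) := by
    rw [← hsig, hs]
    rcases h1 with ⟨h1, -⟩ | ⟨-, h1⟩
    · rw [h1] at hs'
      rw [hs', WithBot.coe_lt_coe]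
      refine lt_of_le_of_ne (Sig.le_mul _ _) fun h0 => hq ⟨q', ?_⟩
      have hy1 : y.1 = 0 := by simpa using congrArg Sig.mon h0
      have : value y = q := by
        rw [show y = (0, q) from Prod.ext hy1 h1, value_zero]
      rwa [this] at h2
    -- Here the old element is multiplied and `q` is its reducer, so already a multiple of `sig q`
    -- lies below the new signature.
    · rw [← h1, ht, WithBot.coe_lt_coe]
      exact (Sig.le_mul m t).trans_lt hlt
  refine ⟨hlt, ?_, ⟨q', h2⟩, _, hs, fun h0 => ?_⟩
  · rcases h1 with ⟨h1, -⟩ | ⟨h1, -⟩ <;> rw [h1]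
    · exact hhom
    · exact hI.hom_done p hp
  · have h3 := hle.trans_lt hlt
    rw [hs, hs', WithBot.coe_lt_coe] at h3
    have hy1 : y.1 = 0 := (add_eq_zero.1 h0).1
    rw [hy1, Sig.zero_mul] at h3
    exact lt_irrefl _ h3

/-- Replacing the entry keeps all signatures in `Rules`. The new element of `DONE` has index at most
that of every rule, so it cannot make a rule meet the Syzygy Criterion. -/
theorem store (hI : Invariant ord k S) (hord : IsHomogeneousOrder ord) {x : MPair f} {q : Pair f}
    (hS : S.phase = Phase.reducing x q) (hq : ¬ F5Reducible ord S.DONE S.Rules q) :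
    Invariant ord k { S with
        DONE := insert q S.DONE
        TODO := S.TODO ∪ {y | ∃ p ∈ S.DONE, IsJPair ord q p y}
        Rules := replaceRule S.Rules (value x) q
        phase := Phase.idle } := by
  have hcur : S.phase.current = some x := by rw [hS]; rfl
  have hq' := hI.not_topReducible hS hq
  obtain ⟨hx1, hx2, hsig, hhom, -⟩ := hI.reducing x q hS
  have hx0 : x = (0, x.2) := Prod.ext hx1 rfl
  have hxv : value x = x.2 := by
    conv_lhs => rw [hx0]
    exact value_zero _
  have hxR : value x ∈ S.Rules := hxv ▸ hx2
  have hmap := map_sig_replaceRule S.Rules hsig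
  have hlast := hI.current_last x hcur
  have hJ := fun (p : Pair f) (hp : p ∈ S.DONE) (y : MPair f) (hy : IsJPair ord q p y) =>
    hI.jpair_store hS hq' hp hy
  have hold : ∀ r ∈ replaceRule S.Rules (value x) q, ∃ r' ∈ S.Rules, sig ord r' = sig ord r := by
    intro r hr
    have := List.mem_map_of_mem (f := sig ord) hr
    rw [hmap] at this
    exact List.mem_map.1 this
  have hdone : ∀ p ∈ S.DONE, p ∈ replaceRule S.Rules (value x) q := by
    intro p hp
    refine mem_replaceRule.2 (Or.inr ⟨hI.done_rules p hp, ?_⟩)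
    rintro rfl
    exact hI.current_new x hcur hp
  exact
    { rules := by
        refine ⟨?_, ?_⟩
        · rw [hmap]
          exact hI.rules.nodup
        · rw [hmap]
          exact hI.rules.sorted
      hom_todo := by
        rintro y (hy | ⟨p, hp, hy⟩)
        · exact hI.hom_todo y hy
        · exact (hJ p hp y hy).2.1
      hom_done := by
        rintro p (rfl | hp)
        · exact hhom
        · exact hI.hom_done p hp
      todo := by
        rintro y (hy | ⟨p, hp, hy⟩)
        · exact hI.todo y hy
        · exact Or.inr (hJ p hp y hy).2.2
      todo_ge := by
        rintro z hz y (hy | ⟨p, hp, hy⟩)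
        · exact hI.todo_ge z hz y hy
        · obtain rfl := Option.some.inj (hlast.symm.trans hz)
          exact (hJ p hp y hy).1.le
      done_irreducible := by
        rintro p (rfl | hp)
        · exact hq'
        · exact hI.done_irreducible p hp
      done_le := by
        rintro p (rfl | hp)
        · exact ⟨x, hlast, hsig.le⟩
        · exact hI.done_le p hp
      done_rules := by
        rintro p (rfl | hp)
        · exact mem_replaceRule.2 (Or.inl ⟨hxR, rfl⟩)
        · exact hdone p hp
      rules_le := by
        intro r hr y hy
        obtain ⟨r', hr', hrr'⟩ := hold r hr
        rw [← hrr']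
        rcases hy with hy | ⟨p, hp, hy⟩
        · exact hI.rules_le r' hr' y hy
        · refine (hI.rules_le_current x hcur r' hr').trans ?_
          obtain ⟨s, hs⟩ := (hI.current x hcur).exists_sig
          have := (hJ p hp y hy).1.le
          rw [hs] at this ⊢
          exact sigDegLE_of_le hord this
      rules_not_meetsSyzygy := by
        intro r hr hmeet
        obtain ⟨r', hr', hrr'⟩ := hold r hr
        have hmeet' := hmeet.congr (y := (0, r')) (by rw [value_zero, value_zero, hrr'])
        obtain ⟨p, hp, s, t, a, hs, ht, ha, hst, hdiv⟩ := hmeet'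
        rcases hp with rfl | hp
        · obtain ⟨s', t', hs', ht', h⟩ := hI.rules_le_current x hcur r' hr'
          obtain rfl := WithBot.coe_inj.1 (hs.symm.trans hs')
          obtain rfl := WithBot.coe_inj.1 (ht.symm.trans (hsig.trans ht'))
          rcases h with h | h
          · exact absurd h hst.not_gt
          · exact hst.ne h.1
        · exact hI.rules_not_meetsSyzygy r' hr' ⟨p, hp, s, t, a, hs, ht, ha, hst, hdiv⟩
      rules_processed := by
        intro r hr
        rcases mem_replaceRule.1 hr with ⟨-, rfl⟩ | ⟨hr, hne⟩
        · exact Or.inl (Set.mem_insert _ _)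
        · rcases hI.rules_processed r hr with h | h | h
          · exact Or.inl (Set.mem_insert_of_mem _ h)
          · exact Or.inr (Or.inl (Or.inl h))
          · obtain rfl := Option.some.inj (hcur.symm.trans h)
            exact absurd (value_zero r).symm hne
      initial_processed := by
        intro i
        rw [hmap]
        exact (hI.initial_processed i).imp Or.inl id
      initial_new := by
        intro i hi p hp
        rcases hi with hi | ⟨p', hp', hi⟩
        · rcases hp with rfl | hp
          · intro h
            have := (hI.current x hcur).eq_initial (hsig.symm.trans h)
            exact hI.current_notMem x hcur (this ▸ hi)
          · exact hI.initial_new i hi p hp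
        · obtain ⟨s, hs, hs0⟩ := (hJ p' hp' _ hi).2.2.2
          rw [value_zero, sig_initialPair, WithBot.coe_inj] at hs
          exact absurd (congrArg Sig.mon hs).symm hs0
      jpairs_processed := by
        rintro r (rfl | hr) p (rfl | hp) y hy
        · exact absurd rfl hy.2.2.1
        · exact Or.inl (Or.inr ⟨p, hp, hy⟩)
        · exact Or.inl (Or.inr ⟨r, hr, hy.symm⟩)
        · rcases hI.jpairs_processed r hr p hp y hy with h | h | h
          · exact Or.inl (Or.inl h)
          · exact Or.inr (Or.inl h)
          · exact Or.inr (Or.inr (h.replaceRule hI.rules.nodup hsig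
              (hI.done_rules _ (hI.jpair_ne_zero hr hp hy).1)))
      current_last := fun y hy => by cases hy
      current_notMem := fun y hy => by cases hy
      current_hom := fun y hy => by cases hy
      current := fun y hy => by cases hy
      rules_le_current := fun y hy => by cases hy
      current_passes := fun y hy => by cases hy
      current_new := fun y hy => by cases hy
      reducing := fun y q hy => by cases hy }

theorem step (hI : Invariant ord k S) (hord : IsHomogeneousOrder ord) {T : State f}
    (h : Step ord S T) : Invariant ord k T := by
  cases h with
  | rule x hS hx => exact hI.rule hS hx
  | select x hS hrule hx hmin => exact hI.select hord hS hrule hx hmin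
  | discard x hS hx => exact hI.discard hS hx
  | start x hS hx => exact hI.start hS hx
  | reduce x q y hS hy hq => exact hI.reduce hS hy hq
  | store x q hS hq hb => exact hI.store hord hS hq
  | block x q hS hq hb => exact absurd hb (hI.not_blocked hS hq)

end Invariant

theorem Reachable.invariant (hord : IsHomogeneousOrder ord)
    (hk : ∀ i, (f i).IsHomogeneous (k i)) (h : Reachable ord S) : Invariant ord k S := by
  unfold Reachable at h
  induction h with
  | refl => exact invariant_initialState hk
  | tail _ h ih => exact ih.step hord h

end Steps

end TRBF5

/-! ### The theorem, read off from the invariant -/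

theorem mainTheorem3 {K : Type*} [Field K] {n d : ℕ} (ord : MonomialOrder (Fin n))
    (hord : TRBF5.IsHomogeneousOrder ord) :
    (∀ f : Fin d → MvPolynomial (Fin n) K, (∀ i, ∃ k, (f i).IsHomogeneous k) →
      ∀ S : TRBF5.State f, TRBF5.Reachable ord S →
        ∀ p : TRBF5.Pair f, ¬ TRBF5.IsSyzygy ord p → TRBF5.Considered ord S p →
          (TRBF5.TopReducible ord p → TRBF5.F5Reducible ord S.DONE S.Rules p) ∧
          (p ∈ S.Rules → p ∈ S.DONE) ∧
          (TRBF5.IsTRP ord p → ∃ x : TRBF5.MPair f, x.2 ∈ S.DONE ∧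
            TRBF5.PassesF5 ord S.DONE S.Rules x ∧ TRBF5.Equivalent ord p (TRBF5.value x)) ∧
          (TRBF5.IsTRB ord p → ∃ p₁ ∈ S.DONE, TRBF5.Equivalent ord p p₁)) ∧
    TRBF5.IsRegularTRB K d ord := by
  refine ⟨fun f hf S hS p hp hcons => ?_, fun f hf => ⟨fun S x q hS hph hq => ?_,
    fun S hS hterm p hp => ?_⟩⟩
  · choose k hk using hf
    have hI := hS.invariant hord hk
    obtain ⟨z, hz, hlt⟩ := hcons
    have hTODO : ∀ y ∈ S.TODO, TRBF5.sig ord p < TRBF5.sig ord (TRBF5.value y) :=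
      fun y hy => hlt.trans_le (hI.todo_ge z hz y hy)
    have hcur : ∀ y, S.phase.current = some y →
        TRBF5.sig ord p < TRBF5.sig ord (TRBF5.value y) := by
      intro y hy
      obtain rfl := Option.some.inj (hz.symm.trans (hI.current_last y hy))
      exact hlt
    refine ⟨hI.f5Reducible (fun y hy => (hTODO y hy).le) (fun y hy => (hcur y hy).le), ?_, ?_,
      hI.exists_of_isTRB hTODO hcur⟩
    · intro hpR
      rcases hI.rules_processed p hpR with h | h | h
      · exact h
      · have := hTODO _ h
        rw [TRBF5.value_zero] at this
        exact absurd this (lt_irrefl _)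
      · have := hcur _ h
        rw [TRBF5.value_zero] at this
        exact absurd this (lt_irrefl _)
    · intro hpT
      obtain ⟨s, hs⟩ := TRBF5.exists_sig hp
      exact hI.exists_of_isTRP s (fun y hy => hs ▸ hTODO y hy) (fun y hy => hs ▸ hcur y hy) p hpT hs
  · choose k hk using hf
    exact (hS.invariant hord hk).not_topReducible hph hq
  · choose k hk using hf
    refine (hS.invariant hord hk).exists_of_isTRB (fun y hy => ?_) (fun y hy => ?_) hp
    · rw [hterm.2] at hy
      exact hy.elim
    · rw [hterm.1] at hy
      cases hy
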